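/- Let $n,m\ge 1$ be integers, $\gamma>0$, write $z=(x,y)\in\mathbb R^n\times\mathbb R^m=\mathbb R^N$, and let $$\nabla_\gamma u=\bigl(\nabla_x u,\,(1+\gamma)|x|^\gamma\nabla_y u\bigr),\qquad \Delta_\gamma=\Delta_x+(1+\gamma)^2|x|^{2\gamma}\Delta_y,\qquad Q=n+(1+\gamma)m,\qquad 2_\gamma^*=\frac{2Q}{Q-2}.$$ Let $\Omega\subset\mathbb R^N$ be a bounded domain. Let $H^1_{0,\gamma}(\Omega)$ be the completion of $C_c^\infty(\Omega)$ for the norm $\|\nabla_\gamma u\|_{L^2(\Omega)}$, and let $H^1_{\gamma,\mathrm{loc}}(\Omega)$ be the space of functions that are in $L^2_{\mathrm{loc}}(\Omega)$ together with their weak gradient $\nabla_\gamma u$. For $u\in H^1_{\gamma,\mathrm{loc}}(\Omega)$ we say that $u\le 0$ on $\partial\Omega$ if $(u-\varepsilon)^+\in H^1_{0,\gamma}(\Omega)$ for every $\varepsilon>0$, and that $u=0$ on $\partial\Omega$ if $u\le0$ and $-u\le0$ on $\partial\Omega$. Let $\delta>0$, $\lambda>0$ and $1\le p\le 2_\gamma^*-1$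 (the subcritical and critical cases). Let $u_0\in H^1_{\gamma,\mathrm{loc}}(\Omega)$, with $u_0>0$ a.e. in $\Omega$ and $u_0^{-\delta}\in L^1_{\mathrm{loc}}(\Omega)$, be a solution, in the sense of distributions, of the purely singular problem $$-\Delta_\gamma u_0=u_0^{-\delta}\ \text{ in }\Omega,\qquad u_0=0\ \text{ on }\partial\Omega .$$ Let $u\ge 0$ be a nonnegative weak solution of the translated problem $$-\Delta_\gamma u+u_0^{-\delta}-(u+u_0)^{-\delta}=\lambda (u+u_0)^p\ \text{ in }\Omega,\qquad u=0\ \text{ on }\partial\Omega,\qquad (T)_\lambda$$ that is, $u\in H^1_{0,\gamma}(\Omega)$, $u\ge0$ a.e. in $\Omega$, $u_0^{-\delta}-(u+u_0)^{-\delta}\in L^1_{\mathrm{loc}}(\Omega)$, and the equation holds in the sense of distributions. Then $u\in L^r(\Omega)$ for every $r\in[1,\infty)$, and moreover $u\in L^\infty(\Omega)$. -/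

import Mathlib

open MeasureTheory Filter Topology
open scoped ContDiff

noncomputable section

namespace Grushin

/-- The space `ℝⁿ × ℝᵐ` of points `z = (x, y)`, with Lebesgue measure. The Euclidean norm is used
on each factor. -/
abbrev Pt (n m : ℕ) : Type := EuclideanSpace ℝ (Fin n) × EuclideanSpace ℝ (Fin m)

/-- The values of the Grushin gradient: `n` components in `x`, then `m` components in `y`. -/
abbrev Grad (n m : ℕ) : Type := EuclideanSpace ℝ (Fin n ⊕ Fin m)

/-- The homogeneous dimension `Q = n + (1 + γ) m` of the dilations `(x, y) ↦ (t x, t^(1+γ) y)`. -/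
def homDim (n m : ℕ) (γ : ℝ) : ℝ := n + (1 + γ) * m

/-- The critical Sobolev exponent `2 Q / (Q - 2)`. -/
def critExp (n m : ℕ) (γ : ℝ) : ℝ := 2 * homDim n m γ / (homDim n m γ - 2)

variable {n m : ℕ}

/-- The Grushin gradient `(∇ₓ φ, (1 + γ) |x|^γ ∇_y φ)` of a smooth function. -/
def grad (γ : ℝ) (φ : Pt n m → ℝ) (z : Pt n m) : Grad n m :=
  WithLp.toLp 2 (Sum.elim
    (fun i : Fin n => fderiv ℝ φ z (EuclideanSpace.single i 1, 0))
    (fun j : Fin m => (1 + γ) * ‖z.1‖ ^ γ * fderiv ℝ φ z (0, EuclideanSpace.single j 1)))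

/-- Membership in `C_c^∞(Ω)`. -/
structure IsTest (Ω : Set (Pt n m)) (φ : Pt n m → ℝ) : Prop where
  smooth : ContDiff ℝ ∞ φ
  compact : HasCompactSupport φ
  support : tsupport φ ⊆ Ω

/-- `V` is the Grushin gradient of `u` in `Ω` in the weak sense. The coefficient `|x|^γ` does not
depend on `y`, so every component of the gradient is formally anti-selfadjoint. -/
structure IsWeakGrad (γ : ℝ) (Ω : Set (Pt n m)) (u : Pt n m → ℝ) (V : Pt n m → Grad n m) :
    Prop where
  locInt : LocallyIntegrableOn u Ω volume
  locInt_grad : LocallyIntegrableOn V Ω volume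
  by_parts : ∀ φ : Pt n m → ℝ, IsTest Ω φ → ∀ k : Fin n ⊕ Fin m,
    ∫ z in Ω, u z * grad γ φ z k = - ∫ z in Ω, V z k * φ z

/-- `u ∈ H¹_{γ,loc}(Ω)`: `u` and its weak Grushin gradient are square integrable on compact
subsets of `Ω`. -/
def MemH1Loc (γ : ℝ) (Ω : Set (Pt n m)) (u : Pt n m → ℝ) : Prop :=
  ∃ V : Pt n m → Grad n m, IsWeakGrad γ Ω u V ∧
    ∀ K : Set (Pt n m), IsCompact K → K ⊆ Ω →
      MemLp u 2 (volume.restrict K) ∧ MemLp V 2 (volume.restrict K)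

/-- `u ∈ H¹_{0,γ}(Ω)`: `u` and its weak Grushin gradient are in `L²(Ω)` and are `L²`-limits of
`φₖ` and `∇_γ φₖ` with `φₖ ∈ C_c^∞(Ω)`. On a bounded `Ω`, where the Poincaré inequality in `x` holds,
this is the completion of `C_c^∞(Ω)` for the norm `‖∇_γ ·‖_{L²}`. -/
def MemH10 (γ : ℝ) (Ω : Set (Pt n m)) (u : Pt n m → ℝ) : Prop :=
  MemLp u 2 (volume.restrict Ω) ∧
  ∃ V : Pt n m → Grad n m, IsWeakGrad γ Ω u V ∧ MemLp V 2 (volume.restrict Ω) ∧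
    ∃ φ : ℕ → Pt n m → ℝ, (∀ k, IsTest Ω (φ k)) ∧
      Tendsto (fun k => eLpNorm (fun z => φ k z - u z) 2 (volume.restrict Ω)) atTop (𝓝 0) ∧
      Tendsto (fun k => eLpNorm (fun z => grad γ (φ k) z - V z) 2 (volume.restrict Ω))
        atTop (𝓝 0)

/-- `u ≤ 0` on `∂Ω`: `(u - ε)⁺ ∈ H¹_{0,γ}(Ω)` for every `ε > 0`. -/
def BdryNonpos (γ : ℝ) (Ω : Set (Pt n m)) (u : Pt n m → ℝ) : Prop :=
  ∀ ε : ℝ, 0 < ε → MemH10 γ Ω (fun z => max (u z - ε) 0)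

/-- `u₀` solves `-Δ_γ u₀ = u₀^{-δ}`, `u₀ > 0` in `Ω`, `u₀ = 0` on `∂Ω`: the equation holds in the
sense of distributions, and the boundary condition means `u₀ ≤ 0` and `-u₀ ≤ 0` on `∂Ω`. -/
structure IsSingularSolution (γ δ : ℝ) (Ω : Set (Pt n m)) (u₀ : Pt n m → ℝ) : Prop where
  memH1Loc : MemH1Loc γ Ω u₀
  pos : ∀ᵐ z ∂(volume.restrict Ω), 0 < u₀ z
  locInt : LocallyIntegrableOn (fun z => u₀ z ^ (-δ)) Ω volume
  bdry_le : BdryNonpos γ Ω u₀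
  bdry_ge : BdryNonpos γ Ω (fun z => - u₀ z)
  eqn : ∀ V : Pt n m → Grad n m, IsWeakGrad γ Ω u₀ V → ∀ φ : Pt n m → ℝ, IsTest Ω φ →
    ∫ z in Ω, inner ℝ (V z) (grad γ φ z) = ∫ z in Ω, u₀ z ^ (-δ) * φ z

/-- `u` is a weak solution of `-Δ_γ u + g(z, u) = f(z, u)` in `Ω`, `u = 0` on `∂Ω`, where `g` may
take infinite values: `u ∈ H¹_{0,γ}(Ω)`, `g(·, u) ∈ L¹_loc(Ω)` (in particular it is finite almost
everywhere), and the equation holds in the sense of distributions. The weak gradient exists by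
`memH10` and is unique up to null sets. -/
structure IsWeakSolution (γ : ℝ) (Ω : Set (Pt n m)) (g : Pt n m → ℝ → EReal)
    (f : Pt n m → ℝ → ℝ) (u : Pt n m → ℝ) : Prop where
  memH10 : MemH10 γ Ω u
  finite : ∀ᵐ z ∂(volume.restrict Ω), g z (u z) ≠ ⊥ ∧ g z (u z) ≠ ⊤
  locInt_g : LocallyIntegrableOn (fun z => (g z (u z)).toReal) Ω volume
  locInt_f : LocallyIntegrableOn (fun z => f z (u z)) Ω volume
  eqn : ∀ V : Pt n m → Grad n m, IsWeakGrad γ Ω u V → ∀ φ : Pt n m → ℝ, IsTest Ω φ →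
    (∫ z in Ω, inner ℝ (V z) (grad γ φ z)) + ∫ z in Ω, (g z (u z)).toReal * φ z
      = ∫ z in Ω, f z (u z) * φ z

/-- The singular term: `g(z, s) = u₀(z)^{-δ} - (s + u₀(z))^{-δ}` if `s + u₀(z) > 0`, and `-∞`
otherwise. -/
def transG (δ : ℝ) (u₀ : Pt n m → ℝ) (z : Pt n m) (s : ℝ) : EReal :=
  open Classical in
  if 0 < s + u₀ z then ((u₀ z ^ (-δ) - (s + u₀ z) ^ (-δ) : ℝ) : EReal) else ⊥

/-- `u` is a weak solution of the translated problem
`-Δ_γ u + u₀^{-δ} - (u + u₀)^{-δ} = lam (u + u₀)^p` in `Ω`, `u = 0` on `∂Ω`. -/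
def IsTranslatedSolution (γ δ lam p : ℝ) (Ω : Set (Pt n m)) (u₀ u : Pt n m → ℝ) : Prop :=
  IsWeakSolution γ Ω (transG δ u₀) (fun z s => lam * (s + u₀ z) ^ p) u

end Grushin

end

noncomputable section

namespace Grushin

/-! Write q for the critical exponent. Since u ≥ 0, the difference u₀^{-δ} - (u + u₀)^{-δ} is
nonnegative and may be dropped, so u is a weak subsolution with right-hand side λ(u + u₀)^p. Once u₀
is known to be bounded, this is at most A(1 + u)^{q-1}, and De Giorgi's iteration
(`Approx.exists_ae_le`) bounds u; every L^r follows because Ω has finite measure.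

The iteration covers critical growth without any preliminary gain of integrability. With N(b) = ‖(u
- b)⁺‖_q, testing with truncations of u and applying the Sobolev inequality give N(b)² ≤ C N(a')^q
for a' < b. As q > 2 this is superlinear, so N tends to zero along the levels k(2 - 2^{-j}) as soon
as N(k) is small, and N(k) is small for large k because u ∈ L^q.

The same iteration bounds u₀. The boundary condition puts (u₀ - 1)⁺ in H¹₀, and Kato's argument
(`IsSingularSolution.subsolutionAbove`) makes it a subsolution with right-hand side 1. This needs
the weak gradients of u₀ and (u₀ - 1)⁺ to agree on {u₀ > 1}, which is `Approx.weakGrad_eq_zero`.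

The Sobolev inequality (`exists_sobolev`) is proved directly. Averaging over displacements adapted
to the degenerate metric bounds |{ψ = 1}| by |supp ψ|^{2/Q} times the energy of ψ. Applied to
truncations between dyadic levels and summed, this yields the critical exponent. -/

/-! ### Increments of functions along Grushin displacements. -/

instance instIsAddHaarMeasureVolumePt (n m : ℕ) :
    (volume : Measure (Pt n m)).IsAddHaarMeasure :=
  inferInstanceAs ((volume : Measure (EuclideanSpace ℝ (Fin n))).prod
    (volume : Measure (EuclideanSpace ℝ (Fin m)))).IsAddHaarMeasure

theorem continuous_enorm_sq {X F : Type*} [TopologicalSpace X] [SeminormedAddCommGroup F]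
    {f : X → F} (hf : Continuous f) : Continuous fun x => ‖f x‖ₑ ^ 2 :=
  (ENNReal.continuous_pow 2).comp (continuous_enorm.comp hf)

/-- The `L²` norm of an increment of a `C¹` function is at most that of the directional derivative. -/
theorem lintegral_sub_translate_sq_le {E : Type*} [NormedAddCommGroup E] [NormedSpace ℝ E]
    [FiniteDimensional ℝ E] [MeasurableSpace E] [BorelSpace E] (μ : Measure E)
    [μ.IsAddHaarMeasure] {f : E → ℝ} (hf : ContDiff ℝ 1 f) (v : E) :
    ∫⁻ y, ‖f (y + v) - f y‖ₑ ^ 2 ∂μ ≤ ∫⁻ y, ‖fderiv ℝ f y v‖ₑ ^ 2 ∂μ := by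
  have hc : Continuous fun y => fderiv ℝ f y v :=
    (hf.continuous_fderiv one_ne_zero).clm_apply continuous_const
  have key : ∀ y, ‖f (y + v) - f y‖ₑ ^ 2 ≤
      ∫⁻ s in Set.Icc (0 : ℝ) 1, ‖fderiv ℝ f (y + s • v) v‖ₑ ^ 2 := by
    intro y
    have hcs : Continuous fun s : ℝ => fderiv ℝ f (y + s • v) v :=
      hc.comp (by fun_prop)
    have h1 : ∫ s in (0 : ℝ)..1, fderiv ℝ f (y + s • v) v = f (y + v) - f y := by
      have := intervalIntegral.integral_eq_sub_of_hasDerivAt (a := 0) (b := 1)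
        (f := fun s : ℝ => f (y + s • v)) (f' := fun s : ℝ => fderiv ℝ f (y + s • v) v)
        (fun s _ => by
          have h2 : HasDerivAt (fun s : ℝ => y + s • v) v s := by
            simpa using ((hasDerivAt_id s).smul_const v).const_add y
          exact ((hf.differentiable one_ne_zero) (y + s • v)).hasFDerivAt.comp_hasDerivAt s h2)
        (hcs.intervalIntegrable _ _)
      simpa using this
    have h3 : ‖f (y + v) - f y‖ₑ ≤
        ∫⁻ s in Set.Icc (0 : ℝ) 1, ‖fderiv ℝ f (y + s • v) v‖ₑ := by
      rw [← h1, intervalIntegral.integral_of_le zero_le_one, restrict_Ioc_eq_restrict_Icc]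
      exact enorm_integral_le_lintegral_enorm _
    -- The unit interval carries a probability measure, so the L¹ norm in s is at most the L² norm.
    have : IsProbabilityMeasure (volume.restrict (Set.Icc (0 : ℝ) 1)) := ⟨by simp⟩
    have h4 := eLpNorm_le_eLpNorm_of_exponent_le (μ := volume.restrict (Set.Icc (0 : ℝ) 1))
      (p := 1) (q := 2) (by norm_num) hcs.aestronglyMeasurable
    rw [eLpNorm_one_eq_lintegral_enorm] at h4
    calc ‖f (y + v) - f y‖ₑ ^ 2 ≤ _ := pow_le_pow_left' (h3.trans h4) 2
      _ = _ := by
        simpa using eLpNorm_nnreal_pow_eq_lintegral (p := 2)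
          (μ := volume.restrict (Set.Icc (0 : ℝ) 1)) (f := fun s : ℝ => fderiv ℝ f (y + s • v) v)
          two_ne_zero
  calc ∫⁻ y, ‖f (y + v) - f y‖ₑ ^ 2 ∂μ
      ≤ ∫⁻ y, (∫⁻ s : ℝ in Set.Icc (0 : ℝ) 1, ‖fderiv ℝ f (y + s • v) v‖ₑ ^ 2) ∂μ :=
        lintegral_mono key
    _ = ∫⁻ s : ℝ in Set.Icc (0 : ℝ) 1, ∫⁻ y, ‖fderiv ℝ f (y + s • v) v‖ₑ ^ 2 ∂μ := by
        apply lintegral_lintegral_swap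
        have : Continuous fun p : E × ℝ => ‖fderiv ℝ f (p.1 + p.2 • v) v‖ₑ ^ 2 := by
          have : Continuous fun p : E × ℝ => fderiv ℝ f (p.1 + p.2 • v) v := hc.comp (by fun_prop)
          exact continuous_enorm_sq this
        exact this.measurable.aemeasurable
    _ = ∫⁻ _ : ℝ in Set.Icc (0 : ℝ) 1, ∫⁻ y, ‖fderiv ℝ f y v‖ₑ ^ 2 ∂μ := by
        congr 1 with s
        exact lintegral_add_right_eq_self (fun y => ‖fderiv ℝ f y v‖ₑ ^ 2) (s • v)
    _ = _ := by simp

variable {n m : ℕ}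

theorem grad_inl (γ : ℝ) (φ : Pt n m → ℝ) (z : Pt n m) (i : Fin n) :
    grad γ φ z (Sum.inl i) = fderiv ℝ φ z (EuclideanSpace.single i 1, 0) := rfl

theorem grad_inr (γ : ℝ) (φ : Pt n m → ℝ) (z : Pt n m) (j : Fin m) :
    grad γ φ z (Sum.inr j) =
      (1 + γ) * ‖z.1‖ ^ γ * fderiv ℝ φ z (0, EuclideanSpace.single j 1) := rfl

theorem norm_grad_sq (γ : ℝ) (φ : Pt n m → ℝ) (z : Pt n m) :
    ‖grad γ φ z‖ ^ 2 = (∑ i, (grad γ φ z (Sum.inl i)) ^ 2) + ∑ j, (grad γ φ z (Sum.inr j)) ^ 2 := by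
  rw [EuclideanSpace.norm_sq_eq, Fintype.sum_sum_type]
  simp

theorem euclidean_eq_sum_single {k : ℕ} (h : EuclideanSpace ℝ (Fin k)) :
    h = ∑ i, h i • EuclideanSpace.single i (1 : ℝ) := by
  ext j
  simp [Finset.sum_apply, Pi.single_apply]

theorem fderiv_fst_sq_le (γ : ℝ) (φ : Pt n m → ℝ) (z : Pt n m) (h : EuclideanSpace ℝ (Fin n)) :
    (fderiv ℝ φ z (h, 0)) ^ 2 ≤ ‖h‖ ^ 2 * ‖grad γ φ z‖ ^ 2 := by
  have e : fderiv ℝ φ z (h, 0) = ∑ i, h i * grad γ φ z (Sum.inl i) := by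
    have : ((h, 0) : Pt n m) = ∑ i, h i • ((EuclideanSpace.single i (1 : ℝ), 0) : Pt n m) := by
      refine Prod.ext ?_ ?_
      · simpa [Prod.fst_sum] using euclidean_eq_sum_single h
      · simp [Prod.snd_sum]
    rw [this, map_sum]
    simp only [grad_inl, map_smul, smul_eq_mul]
  rw [e]
  refine (Finset.sum_mul_sq_le_sq_mul_sq _ _ _).trans ?_
  have e2 : ‖h‖ ^ 2 = ∑ i, (h i) ^ 2 := by simp [EuclideanSpace.norm_sq_eq]
  rw [e2, norm_grad_sq]
  gcongr
  exact le_add_of_nonneg_right (Finset.sum_nonneg fun _ _ => sq_nonneg _)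

theorem fderiv_snd_sq_le {γ : ℝ} (hγ : 0 < γ) (φ : Pt n m → ℝ) (z : Pt n m)
    (h : EuclideanSpace ℝ (Fin m)) :
    (‖z.1‖ ^ γ * fderiv ℝ φ z (0, h)) ^ 2 ≤ ‖h‖ ^ 2 * ‖grad γ φ z‖ ^ 2 := by
  have e : (1 + γ) * (‖z.1‖ ^ γ * fderiv ℝ φ z (0, h)) =
      ∑ i, h i * grad γ φ z (Sum.inr i) := by
    have : ((0, h) : Pt n m) = ∑ i, h i • ((0, EuclideanSpace.single i (1 : ℝ)) : Pt n m) := by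
      refine Prod.ext ?_ ?_
      · simp [Prod.fst_sum]
      · simpa [Prod.snd_sum] using euclidean_eq_sum_single h
    rw [this, map_sum, Finset.mul_sum, Finset.mul_sum]
    refine Finset.sum_congr rfl fun i _ => ?_
    simp only [grad_inr, map_smul, smul_eq_mul]
    ring
  -- The factor 1 + γ ≥ 1 is given away, so that displacements in y need not carry it.
  have h1 : (‖z.1‖ ^ γ * fderiv ℝ φ z (0, h)) ^ 2 ≤
      ((1 + γ) * (‖z.1‖ ^ γ * fderiv ℝ φ z (0, h))) ^ 2 := by
    rw [mul_pow (1 + γ)]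
    exact le_mul_of_one_le_left (sq_nonneg _) (one_le_pow₀ (by linarith))
  refine h1.trans ?_
  rw [e]
  refine (Finset.sum_mul_sq_le_sq_mul_sq _ _ _).trans ?_
  have e2 : ‖h‖ ^ 2 = ∑ i, (h i) ^ 2 := by simp [EuclideanSpace.norm_sq_eq]
  rw [e2, norm_grad_sq]
  gcongr
  exact le_add_of_nonneg_left (Finset.sum_nonneg fun _ _ => sq_nonneg _)

theorem enorm_sq_le_of_sq_le {F : Type*} [SeminormedAddCommGroup F] {a c : ℝ} {b : F} (hc : 0 ≤ c)
    (h : a ^ 2 ≤ c * ‖b‖ ^ 2) : ‖a‖ₑ ^ 2 ≤ ENNReal.ofReal c * ‖b‖ₑ ^ 2 := by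
  rw [← ofReal_norm, ← ofReal_norm, ← ENNReal.ofReal_pow (norm_nonneg _),
    ← ENNReal.ofReal_pow (norm_nonneg _), ← ENNReal.ofReal_mul hc, Real.norm_eq_abs, sq_abs]
  exact ENNReal.ofReal_le_ofReal h

theorem continuous_grad {γ : ℝ} (hγ : 0 < γ) {φ : Pt n m → ℝ} (hφ : ContDiff ℝ 1 φ) :
    Continuous (grad γ φ) := by
  have hd : ∀ v : Pt n m, Continuous fun z => fderiv ℝ φ z v := fun v =>
    (hφ.continuous_fderiv one_ne_zero).clm_apply continuous_const
  refine (PiLp.continuous_toLp 2 _).comp (continuous_pi ?_)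
  rintro (i | j)
  · exact hd _
  · exact (continuous_const.mul ((continuous_norm.comp continuous_fst).rpow_const
      fun _ => Or.inr hγ.le)).mul (hd _)

theorem lintegral_comp_add_smul {E : Type*} [NormedAddCommGroup E] [NormedSpace ℝ E]
    [FiniteDimensional ℝ E] [MeasurableSpace E] [BorelSpace E] (μ : Measure E)
    [μ.IsAddHaarMeasure] {g : E → ENNReal} (hg : Measurable g) (x : E) {r : ℝ} (hr : 0 < r) :
    ∫⁻ h, g (x + r • h) ∂μ = ENNReal.ofReal ((r ^ Module.finrank ℝ E)⁻¹) * ∫⁻ h, g h ∂μ := by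
  have h1 : ∫⁻ h, g (x + r • h) ∂μ = ∫⁻ h, g (x + h) ∂(Measure.map (fun h => r • h) μ) := by
    exact (lintegral_map (f := fun h => g (x + h)) (hg.comp (measurable_const_add x))
      (measurable_const_smul r)).symm
  rw [h1, Measure.map_addHaar_smul μ hr.ne', lintegral_smul_measure,
    lintegral_add_left_eq_self, abs_of_nonneg (by positivity), smul_eq_mul]

/-- The displaced point `(x', y + r |x'|^γ k)` with `x' = x + r h`. -/
def shift (γ r : ℝ) (z w : Pt n m) : Pt n m :=
  (z.1 + r • w.1, z.2 + (r * ‖z.1 + r • w.1‖ ^ γ) • w.2)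

theorem continuous_shift {γ : ℝ} (hγ : 0 < γ) (r : ℝ) :
    Continuous fun p : Pt n m × Pt n m => shift γ r p.1 p.2 := by
  have h1 : Continuous fun p : Pt n m × Pt n m => p.1.1 + r • p.2.1 := by fun_prop
  have h2 : Continuous fun p : Pt n m × Pt n m => ‖p.1.1 + r • p.2.1‖ ^ γ :=
    h1.norm.rpow_const fun _ => Or.inr hγ.le
  have h3 : Continuous fun p : Pt n m × Pt n m => p.1.2 + (r * ‖p.1.1 + r • p.2.1‖ ^ γ) • p.2.2 :=
    (by fun_prop : Continuous fun p : Pt n m × Pt n m => p.1.2).add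
      ((continuous_const.mul h2).smul (by fun_prop))
  exact h1.prodMk h3

theorem fderiv_prodMk_left {φ : Pt n m → ℝ} (hφ : ContDiff ℝ 1 φ) (x : EuclideanSpace ℝ (Fin n))
    (y k : EuclideanSpace ℝ (Fin m)) :
    fderiv ℝ (fun y => φ (x, y)) y k = fderiv ℝ φ (x, y) (0, k) := by
  have h1 : HasFDerivAt (fun y : EuclideanSpace ℝ (Fin m) => (x, y))
    (ContinuousLinearMap.inr ℝ _ _) y := hasFDerivAt_prodMk_right x y
  have h2 := ((hφ.differentiable one_ne_zero) (x, y)).hasFDerivAt.comp y h1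
  have h3 : fderiv ℝ (fun y => φ (x, y)) y = _ := h2.fderiv
  rw [h3]
  simp

/-- The displacement is a translation by r h in x followed by a move in y with x' = x + r h frozen.
Its y-length r|x'|^γ|k| matches the weight of the y-gradient at x', so each move costs at most r²
times the energy. The weight is taken at x' and not at x, so translation invariance reduces the
second move to `g`. The constant 4 comes from (a + b)² ≤ 2a² + 2b². -/
theorem lintegral_shift_sub_sq_le {γ r : ℝ} (hγ : 0 < γ) (hr : 0 < r) {ψ : Pt n m → ℝ}
    (hψ : ContDiff ℝ 1 ψ) {w : Pt n m} (hw : w ∈ Metric.ball (0 : Pt n m) 1) :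
    ∫⁻ z, ‖ψ (shift γ r z w) - ψ z‖ₑ ^ 2 ≤
      4 * (ENNReal.ofReal (r ^ 2) * ∫⁻ z, ‖grad γ ψ z‖ₑ ^ 2) := by
  set D := ∫⁻ z, ‖grad γ ψ z‖ₑ ^ 2 with hD
  have hw' : ‖w‖ ≤ 1 := (mem_ball_zero_iff.1 hw).le
  have hw1 : ‖w.1‖ ≤ 1 := (norm_fst_le w).trans hw'
  have hw2 : ‖w.2‖ ≤ 1 := (norm_snd_le w).trans hw'
  have hcg : Measurable fun z => ‖grad γ ψ z‖ₑ ^ 2 :=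
    (continuous_enorm_sq (continuous_grad hγ hψ)).measurable
  set g : Pt n m → ENNReal := fun z =>
    ‖ψ (z.1, z.2 + (r * ‖z.1‖ ^ γ) • w.2) - ψ z‖ₑ ^ 2 with hg
  have hgm : Continuous g := by
    have h2 : Continuous fun z : Pt n m => ‖z.1‖ ^ γ :=
      continuous_fst.norm.rpow_const fun _ => Or.inr hγ.le
    have h3 : Continuous fun z : Pt n m => (z.1, z.2 + (r * ‖z.1‖ ^ γ) • w.2) :=
      continuous_fst.prodMk (continuous_snd.add ((continuous_const.mul h2).smul continuous_const))
    exact continuous_enorm_sq ((hψ.continuous.comp h3).sub hψ.continuous)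
  have hA : ∫⁻ z, ‖ψ (z + (r • w.1, 0)) - ψ z‖ₑ ^ 2 ≤ ENNReal.ofReal (r ^ 2) * D := by
    refine (lintegral_sub_translate_sq_le volume hψ _).trans ?_
    rw [hD, ← lintegral_const_mul _ hcg]
    refine lintegral_mono fun z => enorm_sq_le_of_sq_le (sq_nonneg r) ?_
    refine (fderiv_fst_sq_le γ ψ z _).trans ?_
    gcongr
    rw [norm_smul, Real.norm_of_nonneg hr.le]
    exact mul_le_of_le_one_right hr.le hw1
  have hB : ∫⁻ z, g z ≤ ENNReal.ofReal (r ^ 2) * D := by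
    rw [hD, ← lintegral_const_mul _ hcg, Measure.volume_eq_prod,
      lintegral_prod _ hgm.measurable.aemeasurable,
      lintegral_prod _ (hcg.const_mul _).aemeasurable]
    refine lintegral_mono fun x => ?_
    have hψx : ContDiff ℝ 1 fun y => ψ (x, y) := hψ.comp (contDiff_const.prodMk contDiff_id)
    refine (lintegral_sub_translate_sq_le volume hψx ((r * ‖x‖ ^ γ) • w.2)).trans ?_
    refine lintegral_mono fun y => enorm_sq_le_of_sq_le (sq_nonneg r) ?_
    rw [fderiv_prodMk_left hψ]
    have e : fderiv ℝ ψ (x, y) (0, (r * ‖x‖ ^ γ) • w.2) =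
        r * (‖x‖ ^ γ * fderiv ℝ ψ (x, y) (0, w.2)) := by
      have : ((0, (r * ‖x‖ ^ γ) • w.2) : Pt n m) = (r * ‖x‖ ^ γ) • ((0, w.2) : Pt n m) := by simp
      rw [this, map_smul, smul_eq_mul, mul_assoc]
    rw [e, mul_pow]
    refine mul_le_mul_of_nonneg_left ((fderiv_snd_sq_le hγ ψ (x, y) w.2).trans ?_) (sq_nonneg r)
    refine mul_le_of_le_one_left (sq_nonneg _) ?_
    exact pow_le_one₀ (norm_nonneg _) hw2
  have hC : ∫⁻ z, g (z + (r • w.1, 0)) = ∫⁻ z, g z :=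
    lintegral_add_right_eq_self g ((r • w.1, 0) : Pt n m)
  have hpt : ∀ z, ‖ψ (shift γ r z w) - ψ z‖ₑ ^ 2 ≤
      2 * (g (z + (r • w.1, 0)) + ‖ψ (z + (r • w.1, 0)) - ψ z‖ₑ ^ 2) := by
    intro z
    have e : ψ (shift γ r z w) - ψ z = (ψ (shift γ r z w) - ψ (z + (r • w.1, 0))) +
      (ψ (z + (r • w.1, 0)) - ψ z) := by ring
    have e2 : g (z + (r • w.1, 0)) = ‖ψ (shift γ r z w) - ψ (z + (r • w.1, 0))‖ₑ ^ 2 := by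
      simp [hg, shift]
    rw [e, e2]
    refine (pow_le_pow_left' (enorm_add_le _ _) 2).trans ?_
    have := ENNReal.rpow_add_le_mul_rpow_add_rpow (‖ψ (shift γ r z w) - ψ (z + (r • w.1, 0))‖ₑ)
      (‖ψ (z + (r • w.1, 0)) - ψ z‖ₑ) (p := 2) (by norm_num)
    have h21 : (2 : ℝ) - 1 = 1 := by norm_num
    rw [h21] at this
    simpa using this
  calc ∫⁻ z, ‖ψ (shift γ r z w) - ψ z‖ₑ ^ 2
      ≤ ∫⁻ z, 2 * (g (z + (r • w.1, 0)) + ‖ψ (z + (r • w.1, 0)) - ψ z‖ₑ ^ 2) :=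
        lintegral_mono hpt
    _ = 2 * ((∫⁻ z, g (z + (r • w.1, 0))) + ∫⁻ z, ‖ψ (z + (r • w.1, 0)) - ψ z‖ₑ ^ 2) := by
        have hm1 : Measurable fun z => g (z + (r • w.1, 0)) :=
          (hgm.comp (continuous_id.add continuous_const)).measurable
        have hm2 : Measurable fun z => ‖ψ (z + (r • w.1, 0)) - ψ z‖ₑ ^ 2 :=
          (continuous_enorm_sq ((hψ.continuous.comp
            (continuous_id.add continuous_const)).sub hψ.continuous)).measurable
        rw [← lintegral_add_left hm1]
        exact lintegral_const_mul _ (hm1.add hm2)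
    _ ≤ 2 * (ENNReal.ofReal (r ^ 2) * D + ENNReal.ofReal (r ^ 2) * D) := by
        rw [hC]; gcongr
    _ = _ := by ring

/-- The map w ↦ `shift γ r z w` has Jacobian r^n (r|x'|^γ)^m, which degenerates at x' = 0. The w
with |x'| < r/4 have first component in a ball of radius 1/4 and fill at most a quarter of the unit
ball. For the others the Jacobian is bounded below, and a change of variables applies. -/
theorem volume_shift_preimage_le (hn : 1 ≤ n) {γ r : ℝ} (hγ : 0 < γ) (hr : 0 < r) {S : Set (Pt n m)}
    (hS : MeasurableSet S) (z : Pt n m) :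
    volume {w ∈ Metric.ball (0 : Pt n m) 1 | shift γ r z w ∈ S} ≤
      volume (Metric.ball (0 : Pt n m) 1) / 4 +
        ENNReal.ofReal (((r * (r / 4) ^ γ) ^ m)⁻¹ * (r ^ n)⁻¹) * volume S := by
  set A₁ : Set (Pt n m) := Metric.ball (-(r⁻¹ • z.1)) (1 / 4) ×ˢ Metric.ball 0 1 with hA₁
  set A₂ : Set (Pt n m) := {w | r / 4 ≤ ‖z.1 + r • w.1‖ ∧ shift γ r z w ∈ S} with hA₂
  have hsub : {w ∈ Metric.ball (0 : Pt n m) 1 | shift γ r z w ∈ S} ⊆ A₁ ∪ A₂ := by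
    rintro w ⟨hw, hwS⟩
    by_cases hc : r / 4 ≤ ‖z.1 + r • w.1‖
    · exact Or.inr ⟨hc, hwS⟩
    · left
      push Not at hc
      have hw2 : w.2 ∈ Metric.ball (0 : EuclideanSpace ℝ (Fin m)) 1 := by
        rw [mem_ball_zero_iff] at hw ⊢
        exact (norm_snd_le w).trans_lt hw
      refine ⟨?_, hw2⟩
      rw [Metric.mem_ball, dist_eq_norm, sub_neg_eq_add]
      have e : z.1 + r • w.1 = r • (w.1 + r⁻¹ • z.1) := by
        rw [smul_add, smul_smul, mul_inv_cancel₀ hr.ne', one_smul, add_comm]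
      rw [e, norm_smul, Real.norm_of_nonneg hr.le] at hc
      have : r * ‖w.1 + r⁻¹ • z.1‖ < r * (1 / 4) := by linarith
      exact lt_of_mul_lt_mul_left this hr.le
  have h₁ : volume A₁ ≤ volume (Metric.ball (0 : Pt n m) 1) / 4 := by
    have e : Metric.ball (0 : Pt n m) 1 = Metric.ball 0 1 ×ˢ Metric.ball 0 1 := by
      rw [ball_prod_same]; rfl
    rw [e, hA₁, Measure.volume_eq_prod, Measure.prod_prod, Measure.prod_prod,
      Measure.addHaar_ball_of_pos volume _ (by norm_num : (0 : ℝ) < 1 / 4)]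
    -- This needs n ≥ 1: the exponent must be at least one.
    have : ENNReal.ofReal ((1 / 4) ^ Module.finrank ℝ (EuclideanSpace ℝ (Fin n))) ≤ 4⁻¹ := by
      rw [finrank_euclideanSpace_fin]
      have h4 : (4 : ENNReal)⁻¹ = ENNReal.ofReal (1 / 4) := by
        rw [one_div, ENNReal.ofReal_inv_of_pos (by norm_num)]; norm_num
      rw [h4]
      apply ENNReal.ofReal_le_ofReal
      exact pow_le_of_le_one (by norm_num) (by norm_num) (by omega)
    rw [ENNReal.div_eq_inv_mul, mul_assoc]
    gcongr
  have hA₂m : MeasurableSet A₂ := by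
    have hc : Continuous fun w : Pt n m => shift γ r z w :=
      (continuous_shift hγ r).comp (continuous_const.prodMk continuous_id)
    have e : A₂ = {w | r / 4 ≤ ‖z.1 + r • w.1‖} ∩ (fun w => shift γ r z w) ⁻¹' S := by
      ext w
      simp [hA₂]
    rw [e]
    refine (measurableSet_le measurable_const ?_).inter (hc.measurable hS)
    exact (by fun_prop : Continuous fun w : Pt n m => ‖z.1 + r • w.1‖).measurable
  set N : EuclideanSpace ℝ (Fin n) → ENNReal := fun x => volume (Prod.mk x ⁻¹' S) with hN
  have hNm : Measurable N := measurable_measure_prodMk_left hS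
  set κ : ENNReal := ENNReal.ofReal (((r * (r / 4) ^ γ) ^ m)⁻¹) with hκ
  have hsec : ∀ h, volume (Prod.mk h ⁻¹' A₂) ≤ κ * N (z.1 + r • h) := by
    intro h
    by_cases hc : r / 4 ≤ ‖z.1 + r • h‖
    · set x' := z.1 + r • h with hx'
      have hρ0 : 0 < r * (r / 4) ^ γ := by positivity
      have hρ : r * (r / 4) ^ γ ≤ r * ‖x'‖ ^ γ := by gcongr
      have hle : volume (Prod.mk h ⁻¹' A₂) ≤
          ∫⁻ k, (Prod.mk x' ⁻¹' S).indicator 1 (z.2 + (r * ‖x'‖ ^ γ) • k) := by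
        have hms : MeasurableSet (Prod.mk h ⁻¹' A₂) := measurable_prodMk_left hA₂m
        rw [← lintegral_indicator_one hms]
        refine lintegral_mono fun k => ?_
        by_cases hk : k ∈ Prod.mk h ⁻¹' A₂
        · have hk2 : z.2 + (r * ‖x'‖ ^ γ) • k ∈ Prod.mk x' ⁻¹' S := hk.2
          rw [Set.indicator_of_mem hk, Set.indicator_of_mem hk2]
          simp
        · rw [Set.indicator_of_notMem hk]
          exact zero_le
      refine hle.trans ?_
      rw [lintegral_comp_add_smul volume
        (measurable_one.indicator (measurable_prodMk_left hS)) _ (hρ0.trans_le hρ),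
        lintegral_indicator_one (measurable_prodMk_left hS), finrank_euclideanSpace_fin]
      gcongr
      exact ENNReal.ofReal_le_ofReal (by gcongr)
    · have : Prod.mk h ⁻¹' A₂ = ∅ := by
        ext k
        simp only [hA₂, Set.mem_preimage, Set.mem_ofPred_eq, Set.mem_empty_iff_false, iff_false]
        exact fun hk => hc hk.1
      rw [this]; simp
  have h₂ : volume A₂ ≤
      ENNReal.ofReal (((r * (r / 4) ^ γ) ^ m)⁻¹ * (r ^ n)⁻¹) * volume S := by
    rw [Measure.volume_eq_prod, Measure.prod_apply hA₂m, Measure.prod_apply hS]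
    refine (lintegral_mono hsec).trans ?_
    have hNc : Measurable fun h => N (z.1 + r • h) :=
      hNm.comp (by fun_prop : Continuous fun h => z.1 + r • h).measurable
    rw [lintegral_const_mul _ hNc, lintegral_comp_add_smul volume hNm _ hr,
      finrank_euclideanSpace_fin, ← mul_assoc, ENNReal.ofReal_mul (by positivity)]
  exact (measure_mono hsub).trans ((measure_union_le _ _).trans (add_le_add h₁ h₂))

/-! ### Level sets: measure against energy. -/

theorem two_lt_homDim (hn : 1 ≤ n) (hm : 1 ≤ m) {γ : ℝ} (hγ : 0 < γ) : 2 < homDim n m γ := by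
  have h1 : (1 : ℝ) ≤ n := by exact_mod_cast hn
  have h2 : (1 : ℝ) ≤ m := by exact_mod_cast hm
  unfold homDim
  nlinarith

/-- The homogeneous dimension enters here, as the order in r of the Jacobian of the displacement. -/
theorem jacobian_eq {γ r : ℝ} (hr : 0 < r) :
    ((r * (r / 4) ^ γ) ^ m)⁻¹ * (r ^ n)⁻¹ = (4 : ℝ) ^ (γ * m) * (r ^ homDim n m γ)⁻¹ := by
  have h1 : (r / 4) ^ γ = r ^ γ * (4 ^ γ)⁻¹ := by
    rw [Real.div_rpow hr.le (by norm_num), div_eq_mul_inv]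
  have h2 : r ^ homDim n m γ = r ^ n * (r * r ^ γ) ^ m := by
    unfold homDim
    rw [Real.rpow_add hr, Real.rpow_natCast, Real.rpow_mul hr.le, Real.rpow_natCast,
      Real.rpow_add hr, Real.rpow_one]
  have h3 : (4 : ℝ) ^ (γ * m) = (4 ^ γ) ^ m := by
    rw [Real.rpow_mul (by norm_num), Real.rpow_natCast]
  have h4 : (0 : ℝ) < 4 ^ γ := by positivity
  have h5 : (0 : ℝ) < r ^ γ := by positivity
  rw [h1, h2, h3, ← mul_assoc, mul_pow _ (4 ^ γ)⁻¹, inv_pow]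
  field_simp

/-- When r is large compared with the support of ψ, at least half of the displacements carry z
outside that support, and along each of these ψ drops from 1 to 0. -/
theorem half_le_lintegral_shift (hn : 1 ≤ n) {γ r : ℝ} (hγ : 0 < γ) (hr : 0 < r)
    {ψ : Pt n m → ℝ} (hψ : Continuous ψ)
    (hr2 : ENNReal.ofReal (((r * (r / 4) ^ γ) ^ m)⁻¹ * (r ^ n)⁻¹) * volume (Function.support ψ) ≤
      volume (Metric.ball (0 : Pt n m) 1) / 4) {z : Pt n m} (hz : ψ z = 1) :
    volume (Metric.ball (0 : Pt n m) 1) / 2 ≤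
      ∫⁻ w in Metric.ball (0 : Pt n m) 1, ‖ψ (shift γ r z w) - ψ z‖ₑ ^ 2 := by
  set B := Metric.ball (0 : Pt n m) 1 with hB
  have hBfin : volume B ≠ ⊤ := measure_ball_lt_top.ne
  have hSm : MeasurableSet (Function.support ψ) := hψ.isOpen_support.measurableSet
  have hcz : Continuous fun w : Pt n m => shift γ r z w :=
    (continuous_shift hγ r).comp (continuous_const.prodMk continuous_id)
  have hP := (volume_shift_preimage_le hn hγ hr hSm z).trans (add_le_add_right hr2 _)
  set P := {w ∈ B | shift γ r z w ∈ Function.support ψ}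
  have hPm : MeasurableSet P := measurableSet_ball.inter (hcz.measurable hSm)
  have h4 : volume B / 4 + volume B / 4 = volume B / 2 := by
    rw [← ENNReal.add_div, ← two_mul]
    have : (4 : ENNReal) = 2 * 2 := by norm_num
    rw [this, ENNReal.mul_div_mul_left _ _ (by norm_num) (by norm_num)]
  rw [h4] at hP
  have hsplit : volume B ≤ volume P + volume (B \ P) := by
    refine (measure_mono ?_).trans (measure_union_le _ _)
    rw [Set.union_sdiff_self]
    exact Set.subset_union_right
  have hdiff : volume B / 2 ≤ volume (B \ P) := by
    have h1 : volume B / 2 + volume B / 2 ≤ volume B / 2 + volume (B \ P) := by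
      rw [ENNReal.add_halves]
      exact hsplit.trans (by gcongr)
    exact (ENNReal.add_le_add_iff_left (ENNReal.div_ne_top hBfin (by norm_num))).1 h1
  refine hdiff.trans ?_
  have hDm : MeasurableSet (B \ P) := measurableSet_ball.diff hPm
  calc volume (B \ P) = ∫⁻ _ in B \ P, 1 := by simp
    _ ≤ ∫⁻ w in B \ P, ‖ψ (shift γ r z w) - ψ z‖ₑ ^ 2 := by
        refine setLIntegral_mono' hDm fun w hw => ?_
        have h0 : ψ (shift γ r z w) = 0 := by
          by_contra hne
          exact hw.2 ⟨hw.1, hne⟩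
        rw [h0, hz]
        simp
    _ ≤ _ := lintegral_mono_set Set.sdiff_subset

/-- The increments are integrated over z and w in both orders: from below by
`half_le_lintegral_shift`, from above by `lintegral_shift_sub_sq_le`. -/
theorem volume_eq_one_le_aux (hn : 1 ≤ n) {γ r : ℝ} (hγ : 0 < γ) (hr : 0 < r)
    {ψ : Pt n m → ℝ} (hψ : ContDiff ℝ 1 ψ)
    (hr2 : ENNReal.ofReal (((r * (r / 4) ^ γ) ^ m)⁻¹ * (r ^ n)⁻¹) * volume (Function.support ψ) ≤
      volume (Metric.ball (0 : Pt n m) 1) / 4) :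
    volume {z | ψ z = 1} ≤ 8 * (ENNReal.ofReal (r ^ 2) * ∫⁻ z, ‖grad γ ψ z‖ₑ ^ 2) := by
  set B := Metric.ball (0 : Pt n m) 1 with hB
  have hBfin : volume B ≠ ⊤ := measure_ball_lt_top.ne
  have hBpos : volume B ≠ 0 := (Metric.measure_ball_pos _ _ one_pos).ne'
  have hEm : MeasurableSet {z | ψ z = 1} := hψ.continuous.measurable (measurableSet_singleton 1)
  set D := ∫⁻ z, ‖grad γ ψ z‖ₑ ^ 2
  have hmeas : Measurable (Function.uncurry fun z w : Pt n m => ‖ψ (shift γ r z w) - ψ z‖ₑ ^ 2) :=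
    (continuous_enorm_sq ((hψ.continuous.comp (continuous_shift hγ r)).sub
      (hψ.continuous.comp continuous_fst))).measurable
  have h1 : volume B / 2 * volume {z | ψ z = 1} ≤ volume B * (4 * (ENNReal.ofReal (r ^ 2) * D)) :=
    calc volume B / 2 * volume {z | ψ z = 1} = ∫⁻ _ in {z | ψ z = 1}, volume B / 2 := by simp
      _ ≤ ∫⁻ z in {z | ψ z = 1}, ∫⁻ w in B, ‖ψ (shift γ r z w) - ψ z‖ₑ ^ 2 :=
          setLIntegral_mono' hEm fun z hz => half_le_lintegral_shift hn hγ hr hψ.continuous hr2 hz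
      _ ≤ ∫⁻ z, ∫⁻ w in B, ‖ψ (shift γ r z w) - ψ z‖ₑ ^ 2 := setLIntegral_le_lintegral _ _
      _ = ∫⁻ w in B, ∫⁻ z, ‖ψ (shift γ r z w) - ψ z‖ₑ ^ 2 :=
          lintegral_lintegral_swap hmeas.aemeasurable
      _ ≤ ∫⁻ _ in B, 4 * (ENNReal.ofReal (r ^ 2) * D) :=
          setLIntegral_mono' measurableSet_ball fun w hw => lintegral_shift_sub_sq_le hγ hr hψ hw
      _ = _ := by rw [setLIntegral_const, mul_comm]
  have h2 : volume B * volume {z | ψ z = 1} ≤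
      volume B * (8 * (ENNReal.ofReal (r ^ 2) * D)) := by
    have h3 := mul_le_mul_right h1 2
    have e1 : 2 * (volume B / 2 * volume {z | ψ z = 1}) = volume B * volume {z | ψ z = 1} := by
      rw [← mul_assoc, ENNReal.mul_div_cancel (by norm_num) (by norm_num)]
    rw [e1] at h3
    refine h3.trans (le_of_eq ?_)
    ring
  exact (ENNReal.mul_le_mul_iff_right hBpos hBfin).1 h2

/-- The isoperimetric form of the Sobolev inequality: a bound for the capacity of a level set. -/
theorem exists_volume_eq_one_le (hn : 1 ≤ n) (hm : 1 ≤ m) {γ : ℝ} (hγ : 0 < γ) :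
    ∃ C : ℝ, 0 < C ∧ ∀ ψ : Pt n m → ℝ, ContDiff ℝ 1 ψ → volume (Function.support ψ) ≠ ⊤ →
      volume {z | ψ z = 1} ≤ ENNReal.ofReal C *
        (volume (Function.support ψ) ^ (2 / homDim n m γ) * ∫⁻ z, ‖grad γ ψ z‖ₑ ^ 2) := by
  set B := Metric.ball (0 : Pt n m) 1 with hB
  have hBfin : volume B ≠ ⊤ := measure_ball_lt_top.ne
  have hBpos : volume B ≠ 0 := (Metric.measure_ball_pos _ _ one_pos).ne'
  set β := (volume B).toReal with hβ
  have hβ0 : 0 < β := ENNReal.toReal_pos hBpos hBfin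
  have hBβ : volume B = ENNReal.ofReal β := (ENNReal.ofReal_toReal hBfin).symm
  set Q := homDim n m γ with hQ
  have hQ2 : 2 < Q := two_lt_homDim hn hm hγ
  set K : ℝ := 4 * 4 ^ (γ * m) / β with hK
  have hK0 : 0 < K := by positivity
  refine ⟨8 * K ^ (2 / Q), by positivity, fun ψ hψ hfin => ?_⟩
  set v := (volume (Function.support ψ)).toReal with hv
  have hSv : volume (Function.support ψ) = ENNReal.ofReal v := (ENNReal.ofReal_toReal hfin).symm
  -- A null support is treated apart, since the radius chosen below would be zero.
  rcases eq_or_lt_of_le (ENNReal.toReal_nonneg : 0 ≤ v) with h0 | hvpos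
  · have : volume {z | ψ z = 1} ≤ volume (Function.support ψ) := by
      refine measure_mono fun z hz => ?_
      simp only [Set.mem_ofPred_eq] at hz
      simp [hz]
    rw [hSv, show v = 0 from h0.symm, ENNReal.ofReal_zero, nonpos_iff_eq_zero] at this
    rw [this]
    exact zero_le
  -- With r^Q = K v the Jacobian term 4^{γm} r^{-Q} v equals |B|/4 exactly, which is what the
  -- averaging requires.
  · set r : ℝ := (K * v) ^ (1 / Q) with hr
    have hKv : 0 < K * v := by positivity
    have hr0 : 0 < r := by positivity
    have hrQ : r ^ Q = K * v := by
      rw [hr, ← Real.rpow_mul hKv.le, one_div_mul_cancel (by linarith), Real.rpow_one]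
    have hr2 : r ^ 2 = K ^ (2 / Q) * v ^ (2 / Q) := by
      rw [hr, ← Real.mul_rpow hK0.le hvpos.le, ← Real.rpow_natCast, ← Real.rpow_mul hKv.le]
      congr 1
      push_cast
      ring
    refine (volume_eq_one_le_aux hn hγ hr0 hψ ?_).trans (le_of_eq ?_)
    · rw [hSv, ← ENNReal.ofReal_mul (by positivity), hBβ, jacobian_eq hr0, ← hQ, hrQ]
      have h4 : ENNReal.ofReal β / 4 = ENNReal.ofReal (β / 4) := by
        rw [ENNReal.ofReal_div_of_pos (by norm_num)]; norm_num
      rw [h4]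
      apply ENNReal.ofReal_le_ofReal
      apply le_of_eq
      rw [hK]
      have : (0 : ℝ) < 4 ^ (γ * m) := by positivity
      field_simp
      exact div_self hvpos.ne'
    · rw [hr2, hSv, ENNReal.ofReal_rpow_of_pos hvpos, ENNReal.ofReal_mul (by positivity),
        ENNReal.ofReal_mul (by positivity)]
      have : ENNReal.ofReal 8 = 8 := by norm_num
      rw [this]
      ring

/-! ### Calculus of the Grushin gradient and truncation between two levels. -/

theorem grad_comp (γ : ℝ) {F : ℝ → ℝ} (hF : Differentiable ℝ F) {φ : Pt n m → ℝ}
    (hφ : Differentiable ℝ φ) (z : Pt n m) :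
    grad γ (fun z => F (φ z)) z = deriv F (φ z) • grad γ φ z := by
  have h : fderiv ℝ (fun z => F (φ z)) z = deriv F (φ z) • fderiv ℝ φ z :=
    ((hF (φ z)).hasDerivAt.comp_hasFDerivAt z (hφ z).hasFDerivAt).fderiv
  ext (i | j)
  · simp only [grad_inl, h, PiLp.smul_apply]
    rfl
  · simp only [grad_inr, h, PiLp.smul_apply, _root_.smul_apply, smul_eq_mul]
    ring

theorem grad_mul (γ : ℝ) {φ ψ : Pt n m → ℝ} (hφ : Differentiable ℝ φ) (hψ : Differentiable ℝ ψ)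
    (z : Pt n m) :
    grad γ (fun z => φ z * ψ z) z = ψ z • grad γ φ z + φ z • grad γ ψ z := by
  have h : fderiv ℝ (fun z => φ z * ψ z) z = φ z • fderiv ℝ ψ z + ψ z • fderiv ℝ φ z :=
    fderiv_fun_mul (hφ z) (hψ z)
  ext (i | j)
  · simp only [grad_inl, h, PiLp.smul_apply, PiLp.add_apply, _root_.add_apply,
      _root_.smul_apply, smul_eq_mul]
    ring
  · simp only [grad_inr, h, PiLp.smul_apply, PiLp.add_apply, _root_.add_apply,
      _root_.smul_apply, smul_eq_mul]
    ring

theorem grad_sub (γ : ℝ) {φ ψ : Pt n m → ℝ} (hφ : Differentiable ℝ φ) (hψ : Differentiable ℝ ψ)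
    (z : Pt n m) :
    grad γ (fun z => φ z - ψ z) z = grad γ φ z - grad γ ψ z := by
  have h : fderiv ℝ (fun z => φ z - ψ z) z = fderiv ℝ φ z - fderiv ℝ ψ z :=
    fderiv_fun_sub (hφ z) (hψ z)
  ext (i | j)
  · simp only [grad_inl, h, PiLp.sub_apply, _root_.sub_apply]
  · simp only [grad_inr, h, PiLp.sub_apply, _root_.sub_apply]
    ring

/-- At such t the function attains its minimum 0 or its maximum 1. -/
theorem deriv_smoothTransition_eq_zero {t : ℝ} (ht : t ≤ 0 ∨ 1 ≤ t) :
    deriv Real.smoothTransition t = 0 := by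
  rcases ht with ht | ht
  · refine IsLocalMin.deriv_eq_zero (Eventually.of_forall fun s => ?_)
    rw [Real.smoothTransition.zero_of_nonpos ht]
    exact Real.smoothTransition.nonneg s
  · refine IsLocalMax.deriv_eq_zero (Eventually.of_forall fun s => ?_)
    rw [Real.smoothTransition.one_of_one_le ht]
    exact Real.smoothTransition.le_one s

theorem exists_deriv_smoothTransition_le :
    ∃ M : ℝ, 0 < M ∧ ∀ t, |deriv Real.smoothTransition t| ≤ M := by
  have hc : Continuous (deriv Real.smoothTransition) :=
    (Real.smoothTransition.contDiff (n := 1)).continuous_deriv le_rfl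
  obtain ⟨M, hM⟩ := hc.bounded_above_of_compact_support
    (HasCompactSupport.of_support_subset_isCompact (isCompact_Icc (a := (0 : ℝ)) (b := 1)) (by
      intro t ht
      by_contra h
      refine ht (deriv_smoothTransition_eq_zero ?_)
      rw [Set.mem_Icc, not_and_or] at h
      rcases h with h | h
      · exact Or.inl (not_le.1 h).le
      · exact Or.inr (not_le.1 h).le))
  exact ⟨max M 1, by positivity, fun t => (hM t).trans (le_max_left _ _)⟩

/-- A bound for the measure of a level set by that of a lower level set and the energy between. -/
theorem exists_volume_level_le (hn : 1 ≤ n) (hm : 1 ≤ m) {γ : ℝ} (hγ : 0 < γ) :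
    ∃ C : ℝ, 0 < C ∧ ∀ φ : Pt n m → ℝ, ContDiff ℝ 1 φ → HasCompactSupport φ → ∀ ρ : ℝ, 0 < ρ →
      volume {z | 2 * ρ ≤ |φ z|} ≤ ENNReal.ofReal (C * (ρ ^ 2)⁻¹) *
        (volume {z | ρ ≤ |φ z|} ^ (2 / homDim n m γ) *
          ∫⁻ z in {z | ρ ≤ |φ z| ∧ |φ z| < 2 * ρ}, ‖grad γ φ z‖ₑ ^ 2) := by
  obtain ⟨C, hC, h⟩ := exists_volume_eq_one_le hn hm hγ
  obtain ⟨M, hM, hτ⟩ := exists_deriv_smoothTransition_le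
  refine ⟨C * (4 / 3 * M) ^ 2, by positivity, fun φ hφ hφc ρ hρ => ?_⟩
  have hQ := two_lt_homDim hn hm hγ
  -- Using t² gives an even function that is smooth at 0. The argument runs from 0 at |t| = ρ to 1
  -- at |t| = 2ρ, and its derivative 2t/(3ρ²) is at most 4/(3ρ) in between.
  set F : ℝ → ℝ := fun t => Real.smoothTransition ((t ^ 2 / ρ ^ 2 - 1) / 3) with hF
  have hFc : ContDiff ℝ 1 F := Real.smoothTransition.contDiff.comp (by fun_prop)
  have hF1 : ∀ t, 2 * ρ ≤ |t| → F t = 1 := by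
    intro t ht
    apply Real.smoothTransition.one_of_one_le
    rw [le_div_iff₀ (by norm_num), ← sq_abs, le_sub_iff_add_le, le_div_iff₀ (by positivity)]
    nlinarith
  have hF0 : ∀ t, |t| ≤ ρ → F t = 0 := by
    intro t ht
    apply Real.smoothTransition.zero_of_nonpos
    have : t ^ 2 / ρ ^ 2 ≤ 1 := by
      rw [div_le_one (by positivity), ← sq_abs t]
      exact pow_le_pow_left₀ (abs_nonneg _) ht 2
    linarith
  have hF' : ∀ t, |deriv F t| ≤
      Set.indicator {t | ρ ≤ |t| ∧ |t| < 2 * ρ} (fun _ => 4 / 3 * M * ρ⁻¹) t := by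
    intro t
    have hd : deriv F t = deriv Real.smoothTransition ((t ^ 2 / ρ ^ 2 - 1) / 3) *
        (2 * t / ρ ^ 2 / 3) := by
      have h1 : HasDerivAt (fun t : ℝ => (t ^ 2 / ρ ^ 2 - 1) / 3) (2 * t / ρ ^ 2 / 3) t := by
        have := (((hasDerivAt_pow 2 t).div_const (ρ ^ 2)).sub_const 1).div_const 3
        simpa using this
      exact (((Real.smoothTransition.contDiff (n := 1)).differentiable one_ne_zero
        _).hasDerivAt.comp t h1).deriv
    by_cases ht : ρ ≤ |t| ∧ |t| < 2 * ρ
    · rw [Set.indicator_of_mem (by exact ht), hd, abs_mul]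
      have h2 : |2 * t / ρ ^ 2 / 3| ≤ 4 / 3 * ρ⁻¹ := by
        rw [abs_div, abs_div, abs_mul, abs_of_pos (by positivity : (0 : ℝ) < ρ ^ 2),
          abs_of_pos (by norm_num : (0 : ℝ) < 3), abs_of_pos (by norm_num : (0 : ℝ) < 2),
          div_div, div_le_iff₀ (by positivity)]
        have : 4 / 3 * ρ⁻¹ * (ρ ^ 2 * 3) = 4 * ρ := by field_simp
        rw [this]
        linarith [ht.2]
      calc _ ≤ M * (4 / 3 * ρ⁻¹) := by gcongr; exact hτ _
        _ = _ := by ring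
    · rw [Set.indicator_of_notMem (by exact ht), hd, deriv_smoothTransition_eq_zero, zero_mul,
        abs_zero]
      rw [not_and_or, not_le, not_lt] at ht
      rcases ht with ht | ht
      · left
        have : t ^ 2 / ρ ^ 2 ≤ 1 := by
          rw [div_le_one (by positivity), ← sq_abs t]
          exact pow_le_pow_left₀ (abs_nonneg _) ht.le 2
        linarith
      · right
        rw [le_div_iff₀ (by norm_num), ← sq_abs, le_sub_iff_add_le, le_div_iff₀ (by positivity)]
        nlinarith
  set ψ : Pt n m → ℝ := fun z => F (φ z) with hψ
  have hψc : ContDiff ℝ 1 ψ := hFc.comp hφ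
  have hsupp : Function.support ψ ⊆ {z | ρ ≤ |φ z|} := by
    intro z hz
    by_contra hlt
    exact hz (hF0 _ (not_le.1 hlt).le)
  have hsupp2 : Function.support ψ ⊆ tsupport φ := by
    refine fun z hz => subset_tsupport _ fun h0 => hz ?_
    simp only [hψ, h0]
    exact hF0 0 (by simpa using hρ.le)
  have hA : MeasurableSet {z | ρ ≤ |φ z| ∧ |φ z| < 2 * ρ} := by
    have hma : Measurable fun z => |φ z| := hφ.continuous.abs.measurable
    exact (measurableSet_le measurable_const hma).inter (measurableSet_lt hma measurable_const)
  have hD : ∫⁻ z, ‖grad γ ψ z‖ₑ ^ 2 ≤ ENNReal.ofReal ((4 / 3 * M * ρ⁻¹) ^ 2) *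
      ∫⁻ z in {z | ρ ≤ |φ z| ∧ |φ z| < 2 * ρ}, ‖grad γ φ z‖ₑ ^ 2 := by
    rw [← lintegral_const_mul _ (continuous_enorm_sq (continuous_grad hγ hφ)).measurable,
      ← lintegral_indicator hA]
    refine lintegral_mono fun z => ?_
    have hg := grad_comp γ (hFc.differentiable one_ne_zero) (hφ.differentiable one_ne_zero) z
    simp only [hψ, hg]
    have hz := hF' (φ z)
    by_cases hc : ρ ≤ |φ z| ∧ |φ z| < 2 * ρ
    · rw [Set.indicator_of_mem (by exact hc)] at hz ⊢
      rw [enorm_smul, mul_pow]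
      gcongr
      rw [← ofReal_norm, ← ENNReal.ofReal_pow (norm_nonneg _)]
      apply ENNReal.ofReal_le_ofReal
      exact pow_le_pow_left₀ (norm_nonneg _) hz 2
    · rw [Set.indicator_of_notMem (by exact hc)] at hz ⊢
      have : deriv F (φ z) = 0 := abs_nonpos_iff.1 hz
      simp [this]
  calc volume {z | 2 * ρ ≤ |φ z|} ≤ volume {z | ψ z = 1} :=
        measure_mono fun z hz => hF1 _ hz
    _ ≤ _ := h ψ hψc ((measure_mono hsupp2).trans_lt hφc.isCompact.measure_lt_top).ne
    _ ≤ ENNReal.ofReal C * (volume {z | ρ ≤ |φ z|} ^ (2 / homDim n m γ) *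
          (ENNReal.ofReal ((4 / 3 * M * ρ⁻¹) ^ 2) *
            ∫⁻ z in {z | ρ ≤ |φ z| ∧ |φ z| < 2 * ρ}, ‖grad γ φ z‖ₑ ^ 2)) := by
        gcongr
    _ = _ := by
        have : C * (4 / 3 * M) ^ 2 * (ρ ^ 2)⁻¹ = C * (4 / 3 * M * ρ⁻¹) ^ 2 := by
          rw [mul_pow _ ρ⁻¹, inv_pow]; ring
        rw [this, ENNReal.ofReal_mul hC.le]
        ring

/-! ### The critical Sobolev inequality by summation over dyadic levels. -/

theorem two_lt_critExp (hn : 1 ≤ n) (hm : 1 ≤ m) {γ : ℝ} (hγ : 0 < γ) : 2 < critExp n m γ := by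
  have hQ := two_lt_homDim hn hm hγ
  unfold critExp
  rw [lt_div_iff₀ (by linarith)]
  linarith

/-- The first identity removes the level ρ from the dyadic estimate; the second gives the exponent
left after dividing by X^{2/Q}. -/
theorem critExp_identities (hn : 1 ≤ n) (hm : 1 ≤ m) {γ : ℝ} (hγ : 0 < γ) :
    critExp n m γ - 2 - critExp n m γ * (2 / homDim n m γ) = 0 ∧
      2 / critExp n m γ = 1 - 2 / homDim n m γ := by
  have hQ := two_lt_homDim hn hm hγ
  unfold critExp
  have h1 : homDim n m γ - 2 ≠ 0 := by linarith
  have h2 : homDim n m γ ≠ 0 := by linarith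
  constructor
  · field_simp
    ring
  · field_simp

theorem lintegral_enorm_rpow_ne_top {φ : Pt n m → ℝ} (hφ : Continuous φ)
    (hφc : HasCompactSupport φ) {q : ℝ} (hq : 0 < q) : ∫⁻ z, ‖φ z‖ₑ ^ q ≠ ⊤ := by
  have h := (hφ.memLp_of_hasCompactSupport (p := ENNReal.ofReal q) (μ := volume) hφc).2
  have := lintegral_rpow_enorm_lt_top_of_eLpNorm_lt_top (by simpa using hq) (by simp) h
  rw [ENNReal.toReal_ofReal hq.le] at this
  exact this.ne

/-- The Sobolev inequality for the Grushin gradient, with the critical exponent. -/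
theorem exists_sobolev (hn : 1 ≤ n) (hm : 1 ≤ m) {γ : ℝ} (hγ : 0 < γ) :
    ∃ C : ℝ, 0 < C ∧ ∀ φ : Pt n m → ℝ, ContDiff ℝ 1 φ → HasCompactSupport φ →
      (∫⁻ z, ‖φ z‖ₑ ^ critExp n m γ) ^ (2 / critExp n m γ) ≤
        ENNReal.ofReal C * ∫⁻ z, ‖grad γ φ z‖ₑ ^ 2 := by
  obtain ⟨C, hC, h⟩ := exists_volume_level_le hn hm hγ
  have hQ := two_lt_homDim hn hm hγ
  have hq2 := two_lt_critExp hn hm hγ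
  obtain ⟨hid1, hid2⟩ := critExp_identities hn hm hγ
  set Q := homDim n m γ
  set q := critExp n m γ
  refine ⟨C * 4 ^ q, by positivity, fun φ hφ hφc => ?_⟩
  set X := ∫⁻ z, ‖φ z‖ₑ ^ q with hX
  set D := ∫⁻ z, ‖grad γ φ z‖ₑ ^ 2 with hD
  -- Finiteness is needed because X is absorbed from the right-hand side at the end.
  have hXfin : X ≠ ⊤ := lintegral_enorm_rpow_ne_top hφ.continuous hφc (by linarith)
  have hma : Measurable fun z => |φ z| := hφ.continuous.abs.measurable
  have hmq : Measurable fun z => ‖φ z‖ₑ ^ q := hφ.continuous.measurable.enorm.pow_const q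
  have henorm : ∀ z, ‖φ z‖ₑ = ENNReal.ofReal |φ z| := fun z => by
    rw [← ofReal_norm]; rfl
  let A : ℝ → Set (Pt n m) := fun ρ => {z | ρ ≤ |φ z| ∧ |φ z| < 2 * ρ}
  have hA : ∀ ρ, MeasurableSet (A ρ) := fun ρ =>
    (measurableSet_le measurable_const hma).inter (measurableSet_lt hma measurable_const)
  have hcheb : ∀ ρ : ℝ, 0 < ρ → volume {z | ρ ≤ |φ z|} ≤ ENNReal.ofReal (ρ ^ (-q)) * X := by
    intro ρ hρ
    have h1 : ENNReal.ofReal (ρ ^ q) * volume {z | ρ ≤ |φ z|} ≤ X := by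
      refine le_trans ?_ (mul_meas_ge_le_lintegral₀ hmq.aemeasurable (ENNReal.ofReal (ρ ^ q)))
      gcongr with z
      intro hz
      rw [henorm, ENNReal.ofReal_rpow_of_pos (hρ.trans_le hz)]
      exact ENNReal.ofReal_le_ofReal (Real.rpow_le_rpow hρ.le hz (by linarith))
    calc volume {z | ρ ≤ |φ z|}
        = ENNReal.ofReal (ρ ^ (-q)) * (ENNReal.ofReal (ρ ^ q) * volume {z | ρ ≤ |φ z|}) := by
          rw [← mul_assoc, ← ENNReal.ofReal_mul (by positivity), ← Real.rpow_add hρ]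
          simp
      _ ≤ _ := by gcongr
  have hlev : ∀ ρ : ℝ, 0 < ρ → ∫⁻ z in A (2 * ρ), ‖φ z‖ₑ ^ q ≤
      ENNReal.ofReal (C * 4 ^ q) * (X ^ (2 / Q) * ∫⁻ z in A ρ, ‖grad γ φ z‖ₑ ^ 2) := by
    intro ρ hρ
    -- All powers of ρ cancel exactly because q is critical, so the bound is uniform over the levels
    -- and can be summed.
    have e1 : (4 * ρ) ^ q * (C * (ρ ^ 2)⁻¹ * ρ ^ (-q * (2 / Q))) = C * 4 ^ q := by
      have : ρ ^ q * (ρ ^ 2)⁻¹ * ρ ^ (-q * (2 / Q)) = 1 := by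
        rw [← Real.rpow_natCast ρ 2, ← Real.rpow_neg hρ.le, ← Real.rpow_add hρ,
          ← Real.rpow_add hρ, show q + -((2 : ℕ) : ℝ) + -q * (2 / Q) = 0 by
            push_cast; linarith, Real.rpow_zero]
      rw [Real.mul_rpow (by norm_num) hρ.le]
      linear_combination (C * 4 ^ q) * this
    calc ∫⁻ z in A (2 * ρ), ‖φ z‖ₑ ^ q ≤ ∫⁻ z in A (2 * ρ), ENNReal.ofReal ((4 * ρ) ^ q) := by
          refine setLIntegral_mono' (hA _) fun z hz => ?_
          rw [henorm, ENNReal.ofReal_rpow_of_nonneg (abs_nonneg _) (by linarith)]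
          refine ENNReal.ofReal_le_ofReal (Real.rpow_le_rpow (abs_nonneg _) ?_ (by linarith))
          have := hz.2
          linarith
      _ = ENNReal.ofReal ((4 * ρ) ^ q) * volume (A (2 * ρ)) := setLIntegral_const _ _
      _ ≤ ENNReal.ofReal ((4 * ρ) ^ q) * volume {z | 2 * ρ ≤ |φ z|} := by
          gcongr
          exact fun z hz => hz.1
      _ ≤ ENNReal.ofReal ((4 * ρ) ^ q) * (ENNReal.ofReal (C * (ρ ^ 2)⁻¹) *
            ((ENNReal.ofReal (ρ ^ (-q)) * X) ^ (2 / Q) * ∫⁻ z in A ρ, ‖grad γ φ z‖ₑ ^ 2)) := by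
          refine mul_le_mul_right ((h φ hφ hφc ρ hρ).trans ?_) _
          gcongr
          exact hcheb ρ hρ
      _ = _ := by
          rw [ENNReal.mul_rpow_of_nonneg _ _ (by positivity),
            ENNReal.ofReal_rpow_of_pos (by positivity), ← Real.rpow_mul hρ.le, ← e1,
            ENNReal.ofReal_mul (p := (4 * ρ) ^ q) (by positivity),
            ENNReal.ofReal_mul (p := C * (ρ ^ 2)⁻¹) (by positivity)]
          ring
  have hzp : ∀ k : ℤ, (0 : ℝ) < 2 ^ k := fun k => by positivity
  have hXsum : X ≤ ∑' k : ℤ, ∫⁻ z in A (2 * 2 ^ k), ‖φ z‖ₑ ^ q := by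
    have hind : ∀ k : ℤ, ∫⁻ z in A (2 * 2 ^ k), ‖φ z‖ₑ ^ q =
        ∫⁻ z, (A (2 * 2 ^ k)).indicator (fun z => ‖φ z‖ₑ ^ q) z := fun k =>
      (lintegral_indicator (hA _) _).symm
    simp_rw [hind]
    rw [← lintegral_tsum fun k => (hmq.indicator (hA _)).aemeasurable]
    refine lintegral_mono fun z => ?_
    by_cases hz : φ z = 0
    · simp [hz, show 0 < q by linarith]
    · obtain ⟨k, hk⟩ := exists_mem_Ico_zpow (abs_pos.2 hz) (one_lt_two : (1 : ℝ) < 2)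
      have hmem : z ∈ A (2 * 2 ^ (k - 1)) := by
        have e : (2 : ℝ) * 2 ^ (k - 1) = 2 ^ k := by
          rw [← zpow_one_add₀ two_ne_zero]; congr 1; ring
        have e2 : (2 : ℝ) * 2 ^ k = 2 ^ (k + 1) := by
          rw [← zpow_one_add₀ two_ne_zero]; congr 1; ring
        rw [e]
        refine ⟨hk.1, ?_⟩
        rw [e2]
        exact hk.2
      calc ‖φ z‖ₑ ^ q = (A (2 * 2 ^ (k - 1))).indicator (fun z => ‖φ z‖ₑ ^ q) z := by
            rw [Set.indicator_of_mem hmem]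
        _ ≤ _ := ENNReal.le_tsum (f := fun k : ℤ =>
            (A (2 * 2 ^ k)).indicator (fun z => ‖φ z‖ₑ ^ q) z) (k - 1)
  -- The dyadic shells are disjoint, so their energies add up to at most the total energy.
  have hDsum : ∑' k : ℤ, ∫⁻ z in A (2 ^ k), ‖grad γ φ z‖ₑ ^ 2 ≤ D := by
    rw [← lintegral_iUnion (fun k => hA _)]
    · exact setLIntegral_le_lintegral _ _
    · intro k l hkl
      rw [Function.onFun, Set.disjoint_left]
      intro z hz1 hz2
      have e2 : ∀ k : ℤ, (2 : ℝ) * 2 ^ k = 2 ^ (k + 1) := fun k => by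
        rw [← zpow_one_add₀ two_ne_zero]; congr 1; ring
      have a1 := hz1.1.trans_lt hz2.2
      have a2 := hz2.1.trans_lt hz1.2
      rw [e2, zpow_lt_zpow_iff_right₀ one_lt_two] at a1 a2
      omega
  have hmain : X ≤ ENNReal.ofReal (C * 4 ^ q) * D * X ^ (2 / Q) :=
    calc X ≤ ∑' k : ℤ, ∫⁻ z in A (2 * 2 ^ k), ‖φ z‖ₑ ^ q := hXsum
      _ ≤ ∑' k : ℤ, ENNReal.ofReal (C * 4 ^ q) *
            (X ^ (2 / Q) * ∫⁻ z in A (2 ^ k), ‖grad γ φ z‖ₑ ^ 2) :=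
          ENNReal.tsum_le_tsum fun k => hlev _ (hzp k)
      _ = ENNReal.ofReal (C * 4 ^ q) *
            (X ^ (2 / Q) * ∑' k : ℤ, ∫⁻ z in A (2 ^ k), ‖grad γ φ z‖ₑ ^ 2) := by
          rw [ENNReal.tsum_mul_left, ENNReal.tsum_mul_left]
      _ ≤ ENNReal.ofReal (C * 4 ^ q) * (X ^ (2 / Q) * D) := by gcongr
      _ = _ := by ring
  rcases eq_or_ne X 0 with h0 | h0
  · rw [h0, ENNReal.zero_rpow_of_pos (by positivity)]
    exact zero_le
  · have hX2 : X ^ (2 / Q) ≠ 0 := by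
      simp [ENNReal.rpow_eq_zero_iff, h0, hXfin]
    have hX3 : X ^ (2 / Q) ≠ ⊤ := ENNReal.rpow_ne_top_of_nonneg (by positivity) hXfin
    rw [hid2, ENNReal.rpow_sub _ _ h0 hXfin, ENNReal.rpow_one]
    exact ENNReal.div_le_of_le_mul hmain

/-! ### Passage to the limit in products. -/

section Limits

variable {α : Type*} [MeasurableSpace α] {μ : Measure α} {E : Type*} [NormedAddCommGroup E]
  [InnerProductSpace ℝ E]

theorem eLpNorm_inner_le {f g : α → E} (hf : AEStronglyMeasurable f μ)
    (hg : AEStronglyMeasurable g μ) :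
    eLpNorm (fun z => (inner ℝ (f z) (g z) : ℝ)) 1 μ ≤ eLpNorm f 2 μ * eLpNorm g 2 μ := by
  have := eLpNorm_le_eLpNorm_mul_eLpNorm_of_nnnorm (p := 2) (q := 2) (r := 1) hf hg
    (fun x y => (inner ℝ x y : ℝ)) 1 (Eventually.of_forall fun z => by
      simpa using nnnorm_inner_le_nnnorm (𝕜 := ℝ) (f z) (g z))
  simpa using this

theorem integrable_inner_of_memLp {f g : α → E} (hf : MemLp f 2 μ) (hg : MemLp g 2 μ) :
    Integrable (fun z => (inner ℝ (f z) (g z) : ℝ)) μ :=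
  memLp_one_iff_integrable.1 ⟨hf.1.inner hg.1,
    (eLpNorm_inner_le hf.1 hg.1).trans_lt (ENNReal.mul_lt_top hf.2 hg.2)⟩

/-- Supplies the L¹-convergent factor in `tendsto_integral_mul_of_bounded`; the bounded factor there
is a nonlinear function of the approximants. -/
theorem tendsto_eLpNorm_inner_sub {X Y : ℕ → α → E} {X' Y' : α → E}
    (hX : ∀ k, MemLp (X k) 2 μ) (hY : ∀ k, MemLp (Y k) 2 μ) (hX' : MemLp X' 2 μ)
    (hY' : MemLp Y' 2 μ)
    (hXl : Tendsto (fun k => eLpNorm (fun z => X k z - X' z) 2 μ) atTop (𝓝 0))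
    (hYl : Tendsto (fun k => eLpNorm (fun z => Y k z - Y' z) 2 μ) atTop (𝓝 0)) :
    Tendsto (fun k => eLpNorm (fun z => (inner ℝ (X k z) (Y k z) : ℝ) - inner ℝ (X' z) (Y' z)) 1 μ)
      atTop (𝓝 0) := by
  set a := fun k => eLpNorm (fun z => X k z - X' z) 2 μ
  set b := fun k => eLpNorm (fun z => Y k z - Y' z) 2 μ
  have hlim : Tendsto (fun k => a k * b k + a k * eLpNorm Y' 2 μ + eLpNorm X' 2 μ * b k) atTop
      (𝓝 0) := by
    have h1 := ENNReal.Tendsto.mul hXl (Or.inr ENNReal.zero_ne_top) hYl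
      (Or.inr ENNReal.zero_ne_top)
    have h2 := ENNReal.Tendsto.mul_const hXl (b := eLpNorm Y' 2 μ) (Or.inr hY'.2.ne)
    have h3 := ENNReal.Tendsto.const_mul hYl (a := eLpNorm X' 2 μ) (Or.inr hX'.2.ne)
    simpa using (h1.add h2).add h3
  refine tendsto_of_tendsto_of_tendsto_of_le_of_le tendsto_const_nhds hlim (fun _ => zero_le)
    fun k => ?_
  have m1 : AEStronglyMeasurable (fun z => X k z - X' z) μ := (hX k).1.sub hX'.1
  have m2 : AEStronglyMeasurable (fun z => Y k z - Y' z) μ := (hY k).1.sub hY'.1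
  have e : (fun z => (inner ℝ (X k z) (Y k z) : ℝ) - inner ℝ (X' z) (Y' z)) =
      ((fun z => (inner ℝ (X k z - X' z) (Y k z - Y' z) : ℝ)) +
        (fun z => (inner ℝ (X k z - X' z) (Y' z) : ℝ))) +
        (fun z => (inner ℝ (X' z) (Y k z - Y' z) : ℝ)) := by
    funext z
    simp only [Pi.add_apply, inner_sub_left, inner_sub_right]
    ring
  rw [e]
  refine (eLpNorm_add_le ((m1.inner m2).add (m1.inner hY'.1)) (hX'.1.inner m2) le_rfl).trans ?_
  refine add_le_add ((eLpNorm_add_le (m1.inner m2) (m1.inner hY'.1) le_rfl).trans ?_)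
    (eLpNorm_inner_le hX'.1 m2)
  exact add_le_add (eLpNorm_inner_le m1 m2) (eLpNorm_inner_le m1 hY'.1)

/-- Bounded factors that converge almost everywhere may be passed to the limit against factors that
converge in `L¹`. -/
theorem tendsto_integral_mul_of_bounded {h : ℕ → α → ℝ} {h' : α → ℝ} {b : ℕ → α → ℝ} {b' : α → ℝ}
    {M : ℝ} (hh : ∀ k, Integrable (h k) μ) (hh' : Integrable h' μ)
    (hlim : Tendsto (fun k => eLpNorm (fun z => h k z - h' z) 1 μ) atTop (𝓝 0))
    (hb : ∀ k, AEStronglyMeasurable (b k) μ) (hM : ∀ k z, |b k z| ≤ M)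
    (hbl : ∀ᵐ z ∂μ, Tendsto (fun k => b k z) atTop (𝓝 (b' z))) :
    Tendsto (fun k => ∫ z, b k z * h k z ∂μ) atTop (𝓝 (∫ z, b' z * h' z ∂μ)) := by
  have h2 : Tendsto (fun k => ∫ z, b k z * h' z ∂μ) atTop (𝓝 (∫ z, b' z * h' z ∂μ)) := by
    refine tendsto_integral_of_dominated_convergence (fun z => M * |h' z|)
      (fun k => (hb k).mul hh'.1) (hh'.abs.const_mul M) (fun k => Eventually.of_forall fun z => ?_) ?_
    · rw [Real.norm_eq_abs, abs_mul]
      exact mul_le_mul_of_nonneg_right (hM k z) (abs_nonneg _)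
    · filter_upwards [hbl] with z hz using hz.mul_const _
  have h1 : Tendsto (fun k => ∫ z, b k z * (h k z - h' z) ∂μ) atTop (𝓝 0) := by
    have h0 : Tendsto (fun k => ENNReal.ofReal M * eLpNorm (fun z => h k z - h' z) 1 μ) atTop
        (𝓝 0) := by
      simpa using ENNReal.Tendsto.const_mul hlim (a := ENNReal.ofReal M)
        (Or.inr ENNReal.ofReal_ne_top)
    have := tendsto_integral_of_L1' (μ := μ) (fun _ : α => (0 : ℝ)) aestronglyMeasurable_const
      (F := fun k z => b k z * (h k z - h' z)) (l := atTop)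
      (Eventually.of_forall fun k => ((hh k).sub hh').bdd_mul (c := M) (hb k)
        (Eventually.of_forall fun z => hM k z))
      (tendsto_of_tendsto_of_tendsto_of_le_of_le tendsto_const_nhds h0 (fun _ => zero_le)
        fun k => by
          refine eLpNorm_le_mul_eLpNorm_of_ae_le_mul (Eventually.of_forall fun z => ?_) 1
          simp only [Pi.sub_apply, sub_zero, norm_mul]
          exact mul_le_mul_of_nonneg_right (hM k z) (norm_nonneg _))
    simpa using this
  have h3 := h1.add h2
  rw [zero_add] at h3
  refine h3.congr fun k => ?_
  have i1 : Integrable (fun z => b k z * (h k z - h' z)) μ :=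
    ((hh k).sub hh').bdd_mul (c := M) (hb k) (Eventually.of_forall fun z => hM k z)
  have i2 : Integrable (fun z => b k z * h' z) μ :=
    hh'.bdd_mul (c := M) (hb k) (Eventually.of_forall fun z => hM k z)
  rw [← integral_add i1 i2]
  congr 1 with z
  ring

end Limits

/-! ### Test functions, and Sobolev and energy inequalities in H¹₀. -/

theorem IsTest.contDiff_one {Ω : Set (Pt n m)} {φ : Pt n m → ℝ} (h : IsTest Ω φ) :
    ContDiff ℝ 1 φ :=
  h.smooth.of_le (by exact_mod_cast le_top)

theorem IsTest.differentiable {Ω : Set (Pt n m)} {φ : Pt n m → ℝ} (h : IsTest Ω φ) :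
    Differentiable ℝ φ :=
  h.contDiff_one.differentiable one_ne_zero

theorem support_grad_subset (γ : ℝ) (φ : Pt n m → ℝ) :
    Function.support (grad γ φ) ⊆ tsupport φ := by
  intro z hz
  by_contra h
  refine hz ?_
  have hd : fderiv ℝ φ z = 0 := fderiv_of_notMem_tsupport ℝ h
  ext (i | j)
  · simp [grad_inl, hd]
  · simp [grad_inr, hd]

theorem IsTest.hasCompactSupport_grad {Ω : Set (Pt n m)} {φ : Pt n m → ℝ} (h : IsTest Ω φ)
    (γ : ℝ) : HasCompactSupport (grad γ φ) :=
  HasCompactSupport.of_support_subset_isCompact h.compact.isCompact (support_grad_subset γ φ)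

theorem IsTest.memLp {Ω : Set (Pt n m)} {φ : Pt n m → ℝ} (h : IsTest Ω φ) (p : ENNReal)
    (μ : Measure (Pt n m)) [IsFiniteMeasureOnCompacts μ] : MemLp φ p μ :=
  h.smooth.continuous.memLp_of_hasCompactSupport h.compact

theorem IsTest.memLp_grad {Ω : Set (Pt n m)} {φ : Pt n m → ℝ} (h : IsTest Ω φ) {γ : ℝ}
    (hγ : 0 < γ) (p : ENNReal) (μ : Measure (Pt n m)) [IsFiniteMeasureOnCompacts μ] :
    MemLp (grad γ φ) p μ :=
  (continuous_grad hγ h.contDiff_one).memLp_of_hasCompactSupport (h.hasCompactSupport_grad γ)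

theorem IsTest.comp {Ω : Set (Pt n m)} {φ : Pt n m → ℝ} (h : IsTest Ω φ) {F : ℝ → ℝ}
    (hF : ContDiff ℝ ∞ F) (hF0 : F 0 = 0) : IsTest Ω (fun z => F (φ z)) where
  smooth := hF.comp h.smooth
  compact := h.compact.comp_left (g := F) hF0
  support := (tsupport_comp_subset hF0 φ).trans h.support

theorem IsTest.sub {Ω : Set (Pt n m)} {φ ψ : Pt n m → ℝ} (h : IsTest Ω φ) (h' : IsTest Ω ψ) :
    IsTest Ω (fun z => φ z - ψ z) where
  smooth := h.smooth.sub h'.smooth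
  compact := h.compact.sub h'.compact
  support := (tsupport_sub φ ψ).trans (Set.union_subset h.support h'.support)

theorem IsTest.mul_smooth {Ω : Set (Pt n m)} {φ ψ : Pt n m → ℝ} (h : IsTest Ω φ)
    (h' : ContDiff ℝ ∞ ψ) : IsTest Ω (fun z => φ z * ψ z) where
  smooth := h.smooth.mul h'
  compact := h.compact.mul_right
  support := (tsupport_mul_subset_left).trans h.support

/-- The Sobolev inequality on `Ω`. -/
theorem exists_sobolev_test (hn : 1 ≤ n) (hm : 1 ≤ m) {γ : ℝ} (hγ : 0 < γ) :
    ∃ C : ℝ, 0 < C ∧ ∀ (Ω : Set (Pt n m)) (φ : Pt n m → ℝ), IsTest Ω φ →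
      eLpNorm φ (ENNReal.ofReal (critExp n m γ)) (volume.restrict Ω) ^ 2 ≤
        ENNReal.ofReal C * eLpNorm (grad γ φ) 2 (volume.restrict Ω) ^ 2 := by
  obtain ⟨C, hC, h⟩ := exists_sobolev hn hm hγ
  have hq := two_lt_critExp hn hm hγ
  refine ⟨C, hC, fun Ω φ hφ => ?_⟩
  have h1 := h φ hφ.contDiff_one hφ.compact
  rw [eLpNorm_restrict_eq_of_support_subset ((subset_tsupport φ).trans hφ.support),
    eLpNorm_restrict_eq_of_support_subset ((support_grad_subset γ φ).trans hφ.support)]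
  have e1 : eLpNorm φ (ENNReal.ofReal (critExp n m γ)) volume ^ 2 =
      (∫⁻ z, ‖φ z‖ₑ ^ critExp n m γ) ^ (2 / critExp n m γ) := by
    rw [eLpNorm_eq_lintegral_rpow_enorm_toReal (by simp; linarith) (by simp),
      ENNReal.toReal_ofReal (by linarith), ← ENNReal.rpow_natCast, ← ENNReal.rpow_mul]
    congr 1
    push_cast
    ring
  have e2 : eLpNorm (grad γ φ) 2 volume ^ 2 = ∫⁻ z, ‖grad γ φ z‖ₑ ^ 2 := by
    simpa using eLpNorm_nnreal_pow_eq_lintegral (p := 2) (μ := volume) (f := grad γ φ) two_ne_zero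
  rw [e1, e2]
  exact h1

/-- An element `u` of `H¹_{0,γ}(Ω)` with weak gradient `V`, together with test functions that
approximate it in the norm and almost everywhere. -/
structure Approx (γ : ℝ) (Ω : Set (Pt n m)) (u : Pt n m → ℝ) (V : Pt n m → Grad n m)
    (φ : ℕ → Pt n m → ℝ) : Prop where
  memLp : MemLp u 2 (volume.restrict Ω)
  weak : IsWeakGrad γ Ω u V
  memLp_grad : MemLp V 2 (volume.restrict Ω)
  test : ∀ k, IsTest Ω (φ k)
  lim : Tendsto (fun k => eLpNorm (fun z => φ k z - u z) 2 (volume.restrict Ω)) atTop (𝓝 0)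
  lim_grad : Tendsto (fun k => eLpNorm (fun z => grad γ (φ k) z - V z) 2 (volume.restrict Ω))
    atTop (𝓝 0)
  ae : ∀ᵐ z ∂(volume.restrict Ω), Tendsto (fun k => φ k z) atTop (𝓝 (u z))

/-- L² convergence gives convergence in measure, hence an almost everywhere convergent subsequence;
continuous functions of the approximants then converge too. -/
theorem MemH10.exists_approx {γ : ℝ} {Ω : Set (Pt n m)} {u : Pt n m → ℝ} (h : MemH10 γ Ω u) :
    ∃ V φ, Approx γ Ω u V φ := by
  obtain ⟨hu, V, hV, hV2, φ, hφ, hl, hlg⟩ := h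
  have hm := tendstoInMeasure_of_tendsto_eLpNorm (μ := volume.restrict Ω) (p := 2) (f := φ) (g := u)
    two_ne_zero (fun k => ((hφ k).memLp 2 _).1) hu.1 hl
  obtain ⟨ns, hns, hae⟩ := hm.exists_seq_tendsto_ae
  exact ⟨V, fun k => φ (ns k), hu, hV, hV2, fun k => hφ _, hl.comp hns.tendsto_atTop,
    hlg.comp hns.tendsto_atTop, hae⟩

namespace Approx

variable {γ : ℝ} {Ω : Set (Pt n m)} {u : Pt n m → ℝ} {V : Pt n m → Grad n m}
  {φ : ℕ → Pt n m → ℝ}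

/-- The Sobolev inequality applies to the test function φ_k - φ_l, and Fatou's lemma in l transfers
the bound to φ_k - u. -/
theorem memLp_and_tendsto_critExp (h : Approx γ Ω u V φ) (hn : 1 ≤ n) (hm : 1 ≤ m) (hγ : 0 < γ) :
    MemLp u (ENNReal.ofReal (critExp n m γ)) (volume.restrict Ω) ∧
      Tendsto (fun k => eLpNorm (fun z => φ k z - u z) (ENNReal.ofReal (critExp n m γ))
        (volume.restrict Ω)) atTop (𝓝 0) := by
  obtain ⟨C, hC, hS⟩ := exists_sobolev_test hn hm hγ
  set μ := volume.restrict Ω with hμ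
  set q := ENNReal.ofReal (critExp n m γ)
  set d := fun k => eLpNorm (fun z => grad γ (φ k) z - V z) 2 μ
  have hC2 : ∀ (ψ : Pt n m → ℝ), IsTest Ω ψ →
      eLpNorm ψ q μ ≤ ENNReal.ofReal (√C) * eLpNorm (grad γ ψ) 2 μ := by
    intro ψ hψ
    have h1 := hS Ω ψ hψ
    rw [← Real.sq_sqrt hC.le, ENNReal.ofReal_pow (Real.sqrt_nonneg _), ← mul_pow] at h1
    exact (ENNReal.pow_le_pow_left_iff two_ne_zero).1 h1
  have hk : ∀ k, eLpNorm (fun z => φ k z - u z) q μ ≤ ENNReal.ofReal (√C) * d k := by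
    intro k
    have h1 := Lp.eLpNorm_lim_le_liminf_eLpNorm (p := q) (μ := μ)
      (f := fun l z => φ k z - φ l z)
      (fun l => (((h.test k).sub (h.test l)).memLp q μ).1) (fun z => φ k z - u z) (by
        filter_upwards [h.ae] with z hz using hz.const_sub _)
    refine h1.trans ?_
    have h2 : Tendsto (fun l => ENNReal.ofReal (√C) * (d k + d l)) atTop
        (𝓝 (ENNReal.ofReal (√C) * (d k + 0))) :=
      ENNReal.Tendsto.const_mul (h.lim_grad.const_add _) (Or.inr ENNReal.ofReal_ne_top)
    rw [add_zero] at h2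
    rw [← h2.liminf_eq]
    refine liminf_le_liminf (Eventually.of_forall fun l => ?_)
    refine (hC2 _ ((h.test k).sub (h.test l))).trans (mul_le_mul_right ?_ _)
    have e : grad γ (fun z => φ k z - φ l z) =
        (fun z => grad γ (φ k) z - V z) - (fun z => grad γ (φ l) z - V z) := by
      funext z
      rw [grad_sub γ (h.test k).differentiable (h.test l).differentiable]
      simp
    rw [e]
    exact eLpNorm_sub_le (((h.test k).memLp_grad hγ 2 μ).1.sub h.memLp_grad.1)
      (((h.test l).memLp_grad hγ 2 μ).1.sub h.memLp_grad.1) (by norm_num)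
  have hfin : ∀ k, d k < ⊤ := fun k => (((h.test k).memLp_grad hγ 2 μ).sub h.memLp_grad).2
  refine ⟨?_, tendsto_of_tendsto_of_tendsto_of_le_of_le tendsto_const_nhds (by
    simpa using ENNReal.Tendsto.const_mul h.lim_grad (a := ENNReal.ofReal (√C))
        (Or.inr ENNReal.ofReal_ne_top)) (fun _ => zero_le) hk⟩
  have h1 : MemLp (fun z => φ 0 z - u z) q μ :=
    ⟨((h.test 0).memLp 2 μ).1.sub h.memLp.1,
      (hk 0).trans_lt (ENNReal.mul_lt_top ENNReal.ofReal_lt_top (hfin 0))⟩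
  have h2 := ((h.test 0).memLp q μ).sub h1
  convert! h2 using 1
  funext z
  simp

theorem ae_tendsto_comp (h : Approx γ Ω u V φ) {F : ℝ → ℝ} (hF : Continuous F) :
    ∀ᵐ z ∂(volume.restrict Ω), Tendsto (fun k => F (φ k z)) atTop (𝓝 (F (u z))) := by
  filter_upwards [h.ae] with z hz using (hF.tendsto _).comp hz

/-- The Sobolev inequality for smooth functions of `u`. -/
theorem eLpNorm_comp_sq_le (h : Approx γ Ω u V φ) (hγ : 0 < γ) {C : ℝ} (hC : 0 < C)
    (hS : ∀ (φ : Pt n m → ℝ), IsTest Ω φ →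
      eLpNorm φ (ENNReal.ofReal (critExp n m γ)) (volume.restrict Ω) ^ 2 ≤
        ENNReal.ofReal C * eLpNorm (grad γ φ) 2 (volume.restrict Ω) ^ 2)
    {F : ℝ → ℝ} (hF : ContDiff ℝ ∞ F) (hF0 : F 0 = 0) (hF' : ∀ t, |deriv F t| ≤ 1) :
    eLpNorm (fun z => F (u z)) (ENNReal.ofReal (critExp n m γ)) (volume.restrict Ω) ^ 2 ≤
      ENNReal.ofReal (C * ∫ z in Ω, (deriv F (u z)) ^ 2 * ‖V z‖ ^ 2) := by
  set μ := volume.restrict Ω with hμ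
  set q := ENNReal.ofReal (critExp n m γ)
  have hF1 : ContDiff ℝ 1 F := hF.of_le (by exact_mod_cast le_top)
  have hFd : Continuous (deriv F) := hF1.continuous_deriv le_rfl
  have hlim : Tendsto (fun k => ∫ z, (deriv F (φ k z)) ^ 2 * inner ℝ (grad γ (φ k) z) (grad γ (φ k) z) ∂μ)
      atTop (𝓝 (∫ z, (deriv F (u z)) ^ 2 * inner ℝ (V z) (V z) ∂μ)) := by
    have hg := fun k => (h.test k).memLp_grad hγ 2 μ
    refine tendsto_integral_mul_of_bounded (M := 1)
      (fun k => integrable_inner_of_memLp (hg k) (hg k))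
      (integrable_inner_of_memLp h.memLp_grad h.memLp_grad)
      (tendsto_eLpNorm_inner_sub hg hg h.memLp_grad h.memLp_grad h.lim_grad h.lim_grad)
      (fun k => ((hFd.comp (h.test k).smooth.continuous).pow 2).aestronglyMeasurable)
      (fun k z => ?_) (h.ae_tendsto_comp (hFd.pow 2))
    rw [abs_pow]
    exact pow_le_one₀ (abs_nonneg _) (hF' _)
  simp only [real_inner_self_eq_norm_sq] at hlim
  have hlow := Lp.eLpNorm_lim_le_liminf_eLpNorm (p := q) (μ := μ) (f := fun k z => F (φ k z))
      (fun k => (((h.test k).comp hF hF0).memLp q μ).1) (fun z => F (u z))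
      (h.ae_tendsto_comp hF.continuous)
  have hk : ∀ k, eLpNorm (fun z => F (φ k z)) q μ ≤
      ENNReal.ofReal (√(C * ∫ z, (deriv F (φ k z)) ^ 2 * ‖grad γ (φ k) z‖ ^ 2 ∂μ)) := by
    intro k
    have h1 := hS _ ((h.test k).comp hF hF0)
    have hnn : 0 ≤ C * ∫ z, (deriv F (φ k z)) ^ 2 * ‖grad γ (φ k) z‖ ^ 2 ∂μ :=
      mul_nonneg hC.le (integral_nonneg fun z => by positivity)
    have e : eLpNorm (grad γ (fun z => F (φ k z))) 2 μ ^ 2 =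
        ENNReal.ofReal (∫ z, (deriv F (φ k z)) ^ 2 * ‖grad γ (φ k) z‖ ^ 2 ∂μ) := by
      have e1 := eLpNorm_nnreal_pow_eq_lintegral (p := 2) (μ := μ)
        (f := grad γ (fun z => F (φ k z))) two_ne_zero
      have hint := ((((h.test k).comp hF hF0).memLp_grad hγ 2 μ).integrable_norm_pow
        (p := 2) two_ne_zero)
      have e2 : ∀ z, ‖grad γ (fun z => F (φ k z)) z‖ ^ 2 =
          (deriv F (φ k z)) ^ 2 * ‖grad γ (φ k) z‖ ^ 2 := fun z => by
        rw [grad_comp γ (hF1.differentiable one_ne_zero) (h.test k).differentiable, norm_smul,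
          mul_pow, Real.norm_eq_abs, sq_abs]
      simp only [e2] at hint
      rw [ofReal_integral_eq_lintegral_ofReal hint (Eventually.of_forall fun z => by positivity)]
      simp only [NNReal.coe_ofNat, ENNReal.coe_ofNat, ENNReal.rpow_ofNat] at e1
      rw [e1]
      congr 1 with z
      rw [← e2, ENNReal.ofReal_pow (norm_nonneg _), ofReal_norm]
    rw [e, ← ENNReal.ofReal_mul hC.le, ← Real.sq_sqrt hnn,
      ENNReal.ofReal_pow (Real.sqrt_nonneg _)] at h1
    exact (ENNReal.pow_le_pow_left_iff two_ne_zero).1 h1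
  have hlim2 := (ENNReal.continuous_ofReal.tendsto _).comp
    ((Real.continuous_sqrt.tendsto _).comp (hlim.const_mul C))
  have hle : eLpNorm (fun z => F (u z)) q μ ≤
      ENNReal.ofReal (√(C * ∫ z, (deriv F (u z)) ^ 2 * ‖V z‖ ^ 2 ∂μ)) := by
    refine hlow.trans ?_
    rw [← hlim2.liminf_eq]
    exact liminf_le_liminf (Eventually.of_forall hk)
  have hnn : 0 ≤ C * ∫ z, (deriv F (u z)) ^ 2 * ‖V z‖ ^ 2 ∂μ :=
    mul_nonneg hC.le (integral_nonneg fun z => by positivity)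
  rw [← Real.sq_sqrt hnn, ENNReal.ofReal_pow (Real.sqrt_nonneg _)]
  exact pow_le_pow_left' hle 2

/-- The energy inequality: a differential inequality for `u` may be tested with `F(u)`. -/
theorem energy_le (h : Approx γ Ω u V φ) (hn : 1 ≤ n) (hm : 1 ≤ m) (hγ : 0 < γ)
    {θ f : Pt n m → ℝ} (hθ : AEStronglyMeasurable θ (volume.restrict Ω)) (hθ1 : ∀ z, |θ z| ≤ 1)
    (hf : MemLp f (ENNReal.ofReal (critExp n m γ).conjExponent) (volume.restrict Ω))
    (hineq : ∀ ψ : Pt n m → ℝ, IsTest Ω ψ → (∀ z, 0 ≤ ψ z) →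
      ∫ z in Ω, θ z * inner ℝ (V z) (grad γ ψ z) ≤ ∫ z in Ω, f z * ψ z)
    {F : ℝ → ℝ} (hF : ContDiff ℝ ∞ F) (hF0 : F 0 = 0) (hFn : ∀ t, 0 ≤ F t)
    (hF' : ∀ t, |deriv F t| ≤ 1) :
    Integrable (fun z => f z * F (u z)) (volume.restrict Ω) ∧
      ∫ z in Ω, θ z * (deriv F (u z) * ‖V z‖ ^ 2) ≤ ∫ z in Ω, f z * F (u z) := by
  obtain ⟨hu, hlu⟩ := h.memLp_and_tendsto_critExp hn hm hγ
  set μ := volume.restrict Ω with hμ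
  set q := ENNReal.ofReal (critExp n m γ)
  have hF1 : ContDiff ℝ 1 F := hF.of_le (by exact_mod_cast le_top)
  have hFd : Continuous (deriv F) := hF1.continuous_deriv le_rfl
  have hLip : ∀ s t, |F s - F t| ≤ |s - t| := by
    have := lipschitzWith_of_nnnorm_deriv_le (C := 1) (hF1.differentiable one_ne_zero)
      (fun t => by exact_mod_cast hF' t)
    intro s t
    simpa [Real.dist_eq] using this.dist_le_mul s t
  have hconj : (ENNReal.ofReal (critExp n m γ)).HolderConjugate
      (ENNReal.ofReal (critExp n m γ).conjExponent) :=
    (Real.HolderConjugate.conjExponent (by linarith [two_lt_critExp hn hm hγ])).ennrealOfReal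
  have hconj' := hconj.symm
  have hFu : MemLp (fun z => F (u z)) q μ := by
    refine hu.of_le (hF.continuous.comp_aestronglyMeasurable hu.1)
      (Eventually.of_forall fun z => ?_)
    have := hLip (u z) 0
    rwa [hF0, sub_zero, sub_zero] at this
  have hfu : Integrable (fun z => f z * F (u z)) μ := hf.integrable_mul hFu
  refine ⟨hfu, ?_⟩
  -- F is 1-Lipschitz, so F(φ_k) converges in the critical Lebesgue space, which is dual to that of
  -- f.
  have hright : Tendsto (fun k => ∫ z, f z * F (φ k z) ∂μ) atTop (𝓝 (∫ z, f z * F (u z) ∂μ)) := by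
    refine tendsto_integral_of_L1' _ hfu.1
      (Eventually.of_forall fun k => hf.integrable_mul (((h.test k).comp hF hF0).memLp q μ)) ?_
    have h0 := ENNReal.Tendsto.const_mul hlu
      (a := eLpNorm f (ENNReal.ofReal (critExp n m γ).conjExponent) μ) (Or.inr hf.2.ne)
    rw [mul_zero] at h0
    refine tendsto_of_tendsto_of_tendsto_of_le_of_le tendsto_const_nhds h0 (fun _ => zero_le)
      fun k => ?_
    have e : ((fun z => f z * F (φ k z)) - fun z => f z * F (u z)) =
        f • fun z => F (φ k z) - F (u z) := by
      funext z
      simp [mul_sub]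
    dsimp only
    rw [e]
    refine (eLpNorm_smul_le_mul_eLpNorm
      (p := ENNReal.ofReal (critExp n m γ).conjExponent) (q := q) (r := 1)
      ((((h.test k).comp hF hF0).memLp q μ).1.sub hFu.1) hf.1).trans (mul_le_mul_right ?_ _)
    exact eLpNorm_mono fun z => hLip _ _
  have hleft : Tendsto (fun k => ∫ z, (θ z * deriv F (φ k z)) * inner ℝ (V z) (grad γ (φ k) z) ∂μ)
      atTop (𝓝 (∫ z, (θ z * deriv F (u z)) * inner ℝ (V z) (V z) ∂μ)) := by
    have hg := fun k => (h.test k).memLp_grad hγ 2 μ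
    refine tendsto_integral_mul_of_bounded (M := 1)
      (fun k => integrable_inner_of_memLp h.memLp_grad (hg k))
      (integrable_inner_of_memLp h.memLp_grad h.memLp_grad)
      (tendsto_eLpNorm_inner_sub (fun _ => h.memLp_grad) hg h.memLp_grad h.memLp_grad
        (by simp) h.lim_grad)
      (fun k => hθ.mul (hFd.comp (h.test k).smooth.continuous).aestronglyMeasurable)
      (fun k z => ?_) ?_
    · rw [abs_mul]
      exact mul_le_one₀ (hθ1 z) (abs_nonneg _) (hF' _)
    · filter_upwards [h.ae_tendsto_comp hFd] with z hz using hz.const_mul _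
  simp only [real_inner_self_eq_norm_sq, mul_assoc] at hleft
  refine le_of_tendsto_of_tendsto' hleft hright fun k => ?_
  refine le_trans (le_of_eq ?_) (hineq _ ((h.test k).comp hF hF0) fun z => hFn _)
  congr 1 with z
  rw [grad_comp γ (hF1.differentiable one_ne_zero) (h.test k).differentiable, inner_smul_right]

end Approx

/-! ### De Giorgi's iteration. -/

/-- A smooth convex substitute for `t ↦ (t - a)⁺`. -/
theorem exists_smooth_posPart {a b : ℝ} (ha : 0 ≤ a) (hab : a < b) :
    ∃ F : ℝ → ℝ, ContDiff ℝ ∞ F ∧ F 0 = 0 ∧ (∀ t, 0 ≤ F t) ∧ (∀ t, 0 ≤ deriv F t) ∧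
      (∀ t, deriv F t ≤ 1) ∧ (∀ t ≤ a, deriv F t = 0) ∧ (∀ t, F t ≤ max (t - a) 0) ∧
      ∀ t, max (t - b) 0 ≤ F t := by
  set χ : ℝ → ℝ := fun s => Real.smoothTransition ((s - a) / (b - a)) with hχ
  have hba : 0 < b - a := sub_pos.2 hab
  have hχs : ContDiff ℝ ∞ χ := Real.smoothTransition.contDiff.comp (by fun_prop)
  have hχc : Continuous χ := hχs.continuous
  have hχ0 : ∀ s, 0 ≤ χ s := fun s => Real.smoothTransition.nonneg _
  have hχ1 : ∀ s, χ s ≤ 1 := fun s => Real.smoothTransition.le_one _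
  have hχa : ∀ s ≤ a, χ s = 0 := fun s hs =>
    Real.smoothTransition.zero_of_nonpos (div_nonpos_of_nonpos_of_nonneg (by linarith) hba.le)
  have hχb : ∀ s, b ≤ s → χ s = 1 := fun s hs =>
    Real.smoothTransition.one_of_one_le (by rw [le_div_iff₀ hba]; linarith)
  set F : ℝ → ℝ := fun t => ∫ s in a..t, χ s with hF
  have hd : ∀ t, HasDerivAt F (χ t) t := fun t => (hχc.integral_hasStrictDerivAt a t).hasDerivAt
  have hderiv : deriv F = χ := funext fun t => (hd t).deriv
  have hi : ∀ s t, IntervalIntegrable χ volume s t := fun s t => hχc.intervalIntegrable s t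
  have hFa : ∀ t ≤ a, F t = 0 := by
    intro t ht
    have : ∫ s in a..t, χ s = ∫ s in a..t, (0 : ℝ) :=
      intervalIntegral.integral_congr fun s hs => by
        rw [Set.uIcc_of_ge ht] at hs
        exact hχa s hs.2
    simp [hF, this]
  have hmono : Monotone F := monotone_of_deriv_nonneg (fun t => (hd t).differentiableAt) fun t => by
    rw [hderiv]; exact hχ0 t
  have hFn : ∀ t, 0 ≤ F t := by
    intro t
    rcases le_total t a with h | h
    · rw [hFa t h]
    · rw [← hFa a le_rfl]; exact hmono h
  refine ⟨F, ?_, hFa 0 ha, hFn, fun t => ?_, fun t => ?_, fun t ht => ?_, fun t => ?_, fun t => ?_⟩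
  · rw [contDiff_infty_iff_deriv, hderiv]
    exact ⟨fun t => (hd t).differentiableAt, hχs⟩
  · rw [hderiv]; exact hχ0 t
  · rw [hderiv]; exact hχ1 t
  · rw [hderiv]; exact hχa t ht
  · rcases le_total t a with h | h
    · rw [hFa t h]; exact le_max_right _ _
    · refine le_trans ?_ (le_max_left _ _)
      have : ∫ s in a..t, χ s ≤ ∫ s in a..t, (1 : ℝ) :=
        intervalIntegral.integral_mono_on h (hi _ _) (by simp) fun s _ => hχ1 s
      simpa [hF] using this
  · rcases le_total t b with h | h
    · rw [max_eq_right (by linarith)]; exact hFn t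
    · rw [max_eq_left (by linarith)]
      have h1 : F t = F b + ∫ s in b..t, χ s :=
        (intervalIntegral.integral_add_adjacent_intervals (hi _ _) (hi _ _)).symm
      have h2 : ∫ s in b..t, χ s = ∫ s in b..t, (1 : ℝ) :=
        intervalIntegral.integral_congr fun s hs => by
          rw [Set.uIcc_of_le h] at hs
          exact hχb s hs.1
      rw [h1, h2]
      have := hFn b
      simp
      linarith

/-- Superlinear recursions started at a small value tend to zero. -/
theorem exists_tendsto_zero_of_superlinear {q K L : ℝ} (hq : 2 < q) (hK : 0 < K) (hL : 1 ≤ L) :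
    ∃ ε : ℝ, 0 < ε ∧ ∀ x : ℕ → ℝ, (∀ j, 0 ≤ x j) → x 0 ≤ ε →
      (∀ j, x (j + 1) ^ 2 ≤ K * L ^ j * x j ^ q) → Tendsto x atTop (𝓝 0) := by
  have hq2 : 0 < q - 2 := by linarith
  -- The aim is x_j ≤ ε ρ^j. Inserting this in the recursion leaves K ε^{q-2} (L ρ^{q-2})^j, which
  -- must be at most ρ². The extra 2 makes ρ < 1 even if L = 1.
  set ρ : ℝ := (2 * L)⁻¹ ^ (1 / (q - 2)) with hρ
  have hL2 : 0 < (2 * L)⁻¹ := by positivity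
  have hρ0 : 0 < ρ := by positivity
  have hρ1 : ρ < 1 := Real.rpow_lt_one hL2.le (inv_lt_one_of_one_lt₀ (by linarith)) (by positivity)
  have hρq : ρ ^ (q - 2) = (2 * L)⁻¹ := by
    rw [hρ, ← Real.rpow_mul hL2.le, one_div_mul_cancel hq2.ne', Real.rpow_one]
  set ε : ℝ := (ρ ^ 2 / K) ^ (1 / (q - 2)) with hε
  have hε0 : 0 < ε := by positivity
  have hεq : ε ^ (q - 2) = ρ ^ 2 / K := by
    rw [hε, ← Real.rpow_mul (by positivity), one_div_mul_cancel hq2.ne', Real.rpow_one]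
  have hsplit : ∀ t : ℝ, 0 < t → t ^ q = t ^ (q - 2) * t ^ 2 := fun t ht => by
    rw [← Real.rpow_natCast t 2, ← Real.rpow_add ht]; congr 1; push_cast; ring
  refine ⟨ε, hε0, fun x hx hx0 hrec => ?_⟩
  have hbd : ∀ j, x j ≤ ε * ρ ^ j := by
    intro j
    induction j with
    | zero => simpa using hx0
    | succ j ih =>
      have h1 : x j ^ q ≤ (ε * ρ ^ j) ^ q := Real.rpow_le_rpow (hx j) ih (by linarith)
      have h2 : (ε * ρ ^ j) ^ q = ρ ^ 2 / K * ((2 * L)⁻¹) ^ j * (ε * ρ ^ j) ^ 2 := by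
        rw [hsplit _ (by positivity), Real.mul_rpow hε0.le (by positivity), hεq,
          ← Real.rpow_natCast ρ j, ← Real.rpow_mul hρ0.le, mul_comm (j : ℝ), Real.rpow_mul hρ0.le,
          hρq, Real.rpow_natCast]
      have h3 : K * L ^ j * (ρ ^ 2 / K * ((2 * L)⁻¹) ^ j * (ε * ρ ^ j) ^ 2) =
          (2 : ℝ)⁻¹ ^ j * (ε * ρ ^ (j + 1)) ^ 2 := by
        have hL0 : L ≠ 0 := by positivity
        rw [inv_pow, mul_pow 2 L j, inv_pow]
        field_simp
        ring
      have h4 : x (j + 1) ^ 2 ≤ (ε * ρ ^ (j + 1)) ^ 2 := by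
        refine (hrec j).trans ?_
        refine (mul_le_mul_of_nonneg_left h1 (by positivity)).trans ?_
        rw [h2, h3]
        exact mul_le_of_le_one_left (sq_nonneg _) (pow_le_one₀ (by norm_num) (by norm_num))
      exact (pow_le_pow_iff_left₀ (hx _) (by positivity) two_ne_zero).1 h4
  refine squeeze_zero hx hbd ?_
  simpa using (tendsto_pow_atTop_nhds_zero_of_lt_one hρ0.le hρ1).const_mul ε

section DeGiorgi

variable {γ : ℝ} {Ω : Set (Pt n m)} {u : Pt n m → ℝ} {V : Pt n m → Grad n m}
  {φ : ℕ → Pt n m → ℝ}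

/-- `-Δ_γ u ≤ f` weakly on every set `{u ≥ a}`, `a > 0`. -/
def SubsolutionAbove (γ : ℝ) (Ω : Set (Pt n m)) (u : Pt n m → ℝ) (V : Pt n m → Grad n m)
    (f : Pt n m → ℝ) : Prop :=
  ∀ a : ℝ, 0 < a → ∃ θ : Pt n m → ℝ, AEStronglyMeasurable θ (volume.restrict Ω) ∧
    (∀ z, |θ z| ≤ 1) ∧ (∀ z, a ≤ u z → θ z = 1) ∧
    ∀ ψ : Pt n m → ℝ, IsTest Ω ψ → (∀ z, 0 ≤ ψ z) →
      ∫ z in Ω, θ z * inner ℝ (V z) (grad γ ψ z) ≤ ∫ z in Ω, f z * ψ z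

theorem memLp_posPart {p : ENNReal} {μ : Measure (Pt n m)} (hu : MemLp u p μ) {b : ℝ} (hb : 0 ≤ b) :
    MemLp (fun z => max (u z - b) 0) p μ := by
  refine hu.of_le ((hu.1.sub aestronglyMeasurable_const).sup aestronglyMeasurable_const)
    (Eventually.of_forall fun z => ?_)
  rw [Real.norm_of_nonneg (le_max_right _ _), Real.norm_eq_abs]
  exact max_le (by linarith [le_abs_self (u z)]) (abs_nonneg _)

/-- A Caccioppoli-type bound: F(u), with F a smooth convex function between (t - b)⁺ and (t - a)⁺,
serves both as test function and in the Sobolev inequality. -/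
theorem Approx.eLpNorm_posPart_sq_le (h : Approx γ Ω u V φ) (hn : 1 ≤ n) (hm : 1 ≤ m) (hγ : 0 < γ)
    {C : ℝ} (hC : 0 < C)
    (hS : ∀ (φ : Pt n m → ℝ), IsTest Ω φ →
      eLpNorm φ (ENNReal.ofReal (critExp n m γ)) (volume.restrict Ω) ^ 2 ≤
        ENNReal.ofReal C * eLpNorm (grad γ φ) 2 (volume.restrict Ω) ^ 2)
    {f : Pt n m → ℝ}
    (hf : MemLp f (ENNReal.ofReal (critExp n m γ).conjExponent) (volume.restrict Ω))
    (hsub : SubsolutionAbove γ Ω u V f) {a b : ℝ} (ha : 0 < a) (hab : a < b) {g : Pt n m → ℝ}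
    (hg : Integrable g (volume.restrict Ω))
    (hfg : ∀ᵐ z ∂(volume.restrict Ω), |f z| * max (u z - a) 0 ≤ g z) :
    eLpNorm (fun z => max (u z - b) 0) (ENNReal.ofReal (critExp n m γ)) (volume.restrict Ω) ^ 2 ≤
      ENNReal.ofReal (C * ∫ z in Ω, g z) := by
  obtain ⟨F, hF, hF0, hFn, hF'0, hF'1, hF'a, hFle, hFge⟩ := exists_smooth_posPart ha.le hab
  obtain ⟨θ, hθ, hθ1, hθa, hineq⟩ := hsub a ha
  have hF' : ∀ t, |deriv F t| ≤ 1 := fun t => by rw [abs_of_nonneg (hF'0 t)]; exact hF'1 t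
  obtain ⟨hint, hen⟩ := h.energy_le hn hm hγ hθ hθ1 hf hineq hF hF0 hFn hF'
  have h1 := h.eLpNorm_comp_sq_le hγ hC hS hF hF0 hF'
  have hFd : Continuous (deriv F) :=
    (hF.of_le (m := 1) (by exact_mod_cast le_top)).continuous_deriv le_rfl
  have h2 : eLpNorm (fun z => max (u z - b) 0) (ENNReal.ofReal (critExp n m γ))
      (volume.restrict Ω) ≤ eLpNorm (fun z => F (u z)) (ENNReal.ofReal (critExp n m γ))
      (volume.restrict Ω) := by
    refine eLpNorm_mono_real fun z => ?_
    rw [Real.norm_of_nonneg (le_max_right _ _)]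
    exact hFge _
  refine (pow_le_pow_left' h2 2).trans (h1.trans (ENNReal.ofReal_le_ofReal ?_))
  refine mul_le_mul_of_nonneg_left ?_ hC.le
  have hV2 : Integrable (fun z => ‖V z‖ ^ 2) (volume.restrict Ω) :=
    h.memLp_grad.integrable_norm_pow (p := 2) two_ne_zero
  have hm' : AEStronglyMeasurable (fun z => deriv F (u z)) (volume.restrict Ω) :=
    hFd.comp_aestronglyMeasurable h.memLp.1
  have hb1 : ∀ z, ‖(deriv F (u z)) ^ 2‖ ≤ 1 := fun z => by
    rw [norm_pow]; exact pow_le_one₀ (norm_nonneg _) (hF' _)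
  have hb2 : ∀ z, ‖θ z * deriv F (u z)‖ ≤ 1 := fun z => by
    rw [norm_mul]; exact mul_le_one₀ (hθ1 z) (norm_nonneg _) (hF' _)
  calc ∫ z in Ω, (deriv F (u z)) ^ 2 * ‖V z‖ ^ 2
      ≤ ∫ z in Ω, (θ z * deriv F (u z)) * ‖V z‖ ^ 2 := by
        refine integral_mono (hV2.bdd_mul (hm'.pow 2) (Eventually.of_forall hb1))
          (hV2.bdd_mul (hθ.mul hm') (Eventually.of_forall hb2)) fun z => ?_
        -- F' vanishes below a, where θ is not controlled; above a, θ = 1 and 0 ≤ F' ≤ 1 gives (F')²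
        -- ≤ F'.
        refine mul_le_mul_of_nonneg_right ?_ (sq_nonneg _)
        rcases le_total (u z) a with hz | hz
        · simp [hF'a _ hz]
        · rw [hθa z hz, one_mul]
          exact pow_le_of_le_one (hF'0 _) (hF'1 _) two_ne_zero
    _ = ∫ z in Ω, θ z * (deriv F (u z) * ‖V z‖ ^ 2) := by simp only [mul_assoc]
    _ ≤ ∫ z in Ω, f z * F (u z) := hen
    _ ≤ ∫ z in Ω, g z := by
        refine integral_mono_ae hint hg ?_
        filter_upwards [hfg] with z hz
        refine le_trans ?_ hz
        exact mul_le_mul (le_abs_self _) (hFle _) (hFn _) (abs_nonneg _)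

/-- The power q - 1 maps L^q into L^{q/(q-1)}, so critical growth is just enough for f to be paired
with L^q functions. -/
theorem memLp_conjExponent_of_le {μ : Measure (Pt n m)} [IsFiniteMeasure μ] {q A : ℝ} (hq : 1 < q)
    (hu : MemLp u (ENNReal.ofReal q) μ) {f : Pt n m → ℝ} (hf : AEStronglyMeasurable f μ)
    (hfA : ∀ᵐ z ∂μ, |f z| ≤ A * (1 + |u z|) ^ (q - 1)) :
    MemLp f (ENNReal.ofReal q.conjExponent) μ := by
  have h0 : MemLp (fun _ : Pt n m => (1 : ℝ)) (ENNReal.ofReal q) μ := memLp_const 1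
  have h1 : MemLp (fun z => 1 + |u z|) (ENNReal.ofReal q) μ := h0.add hu.norm
  have h2 := (h1.norm_rpow_div (ENNReal.ofReal (q - 1))).const_mul A
  rw [ENNReal.toReal_ofReal (by linarith), ← ENNReal.ofReal_div_of_pos (by linarith)] at h2
  refine h2.mono' hf ?_
  filter_upwards [hfA] with z hz
  rw [Real.norm_of_nonneg (by positivity : 0 ≤ 1 + |u z|)]
  exact hz

/-- Dominated convergence, with |u|^q as majorant. This is the small starting value of the
iteration. -/
theorem exists_toReal_eLpNorm_posPart_le {μ : Measure (Pt n m)} {q ε : ℝ} (hq : 0 < q) (hε : 0 < ε)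
    (hu : MemLp u (ENNReal.ofReal q) μ) :
    ∃ k : ℕ, 1 ≤ k ∧
      (eLpNorm (fun z => max (u z - k) 0) (ENNReal.ofReal q) μ).toReal ≤ ε := by
  have hint : Integrable (fun z => ‖u z‖ ^ q) μ := by
    have := hu.integrable_norm_rpow (by simpa using hq) (by simp)
    rwa [ENNReal.toReal_ofReal hq.le] at this
  have hlim : Tendsto (fun k : ℕ => ∫ z, (max (u z - k) 0) ^ q ∂μ) atTop (𝓝 (∫ _, (0 : ℝ) ∂μ)) := by
    refine tendsto_integral_of_dominated_convergence (fun z => ‖u z‖ ^ q) (fun k => ?_) hint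
      (fun k => Eventually.of_forall fun z => ?_) (Eventually.of_forall fun z => ?_)
    · exact ((memLp_posPart hu k.cast_nonneg).1.aemeasurable.pow_const q).aestronglyMeasurable
    · rw [Real.norm_of_nonneg (by positivity)]
      refine Real.rpow_le_rpow (le_max_right _ _) ?_ hq.le
      rw [Real.norm_eq_abs]
      have : (0 : ℝ) ≤ k := k.cast_nonneg
      exact max_le (by linarith [le_abs_self (u z)]) (abs_nonneg _)
    · refine tendsto_const_nhds.congr' ?_
      filter_upwards [tendsto_natCast_atTop_atTop.eventually_ge_atTop (u z)] with k hk
      rw [max_eq_right (by linarith), Real.zero_rpow hq.ne']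
  rw [integral_zero] at hlim
  have hev := (hlim.eventually_le_const (by positivity : 0 < ε ^ q)).and (eventually_ge_atTop 1)
  obtain ⟨k, hk, hk1⟩ := hev.exists
  refine ⟨k, hk1, ?_⟩
  rw [(memLp_posPart hu k.cast_nonneg).eLpNorm_eq_integral_rpow_norm (by simpa using hq) (by simp),
    ENNReal.toReal_ofReal (by positivity), ENNReal.toReal_ofReal hq.le]
  have e : ∀ z, ‖max (u z - k) 0‖ = max (u z - k) 0 := fun z =>
    Real.norm_of_nonneg (le_max_right _ _)
  simp only [e]
  refine (Real.rpow_le_rpow (integral_nonneg fun z => by positivity) hk (by positivity)).trans ?_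
  rw [← Real.rpow_mul hε.le, mul_inv_cancel₀ hq.ne', Real.rpow_one]

/-- For t ≥ a one has 1 + t ≤ 2t, since a ≥ 1, and t/(t - a') ≤ a/(a - a'), since the left side
decreases in t. The ratio a/(a - a') is scale invariant, so the iteration constants do not depend on
the starting level. -/
theorem abs_mul_posPart_le {q A a a' t s : ℝ} (hq : 1 < q) (hA : 0 ≤ A) (ha' : 1 ≤ a')
    (haa : a' < a) (hs : |s| ≤ A * (1 + |t|) ^ (q - 1)) :
    |s| * max (t - a) 0 ≤ A * (2 * (a / (a - a'))) ^ (q - 1) * (max (t - a') 0) ^ q := by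
  have hd : 0 < a - a' := sub_pos.2 haa
  rcases le_total t a with ht | ht
  · rw [max_eq_right (a := t - a) (by linarith), mul_zero]
    have : 0 ≤ a / (a - a') := div_nonneg (by linarith) hd.le
    positivity
  · have hta' : 0 < t - a' := by linarith
    rw [max_eq_left (a := t - a) (by linarith), max_eq_left hta'.le]
    have h1 : 1 + |t| ≤ 2 * (a / (a - a')) * (t - a') := by
      rw [abs_of_nonneg (by linarith), mul_assoc, div_mul_eq_mul_div, mul_div_assoc',
        le_div_iff₀ hd]
      nlinarith
    have h0 : 0 ≤ 2 * (a / (a - a')) := mul_nonneg two_pos.le (div_nonneg (by linarith) hd.le)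
    calc |s| * (t - a) ≤ (A * (1 + |t|) ^ (q - 1)) * (t - a') := by
          refine mul_le_mul hs (by linarith) (by linarith) (by positivity)
      _ ≤ (A * (2 * (a / (a - a')) * (t - a')) ^ (q - 1)) * (t - a') := by
          refine mul_le_mul_of_nonneg_right (mul_le_mul_of_nonneg_left ?_ hA) hta'.le
          exact Real.rpow_le_rpow (by positivity) h1 (by linarith)
      _ = _ := by
          rw [Real.mul_rpow h0 hta'.le]
          have : (t - a') ^ q = (t - a') ^ (q - 1) * (t - a') := by
            rw [← Real.rpow_add_one hta'.ne']; congr 1; ring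
          rw [this]
          ring

/-- Boundedness of subsolutions with at most critical growth, by De Giorgi's iteration. -/
theorem Approx.exists_ae_le (h : Approx γ Ω u V φ) (hn : 1 ≤ n) (hm : 1 ≤ m) (hγ : 0 < γ)
    (hΩ : volume Ω ≠ ⊤) {f : Pt n m → ℝ} (hf : AEStronglyMeasurable f (volume.restrict Ω))
    {A : ℝ} (hA : 0 < A)
    (hfA : ∀ᵐ z ∂(volume.restrict Ω), |f z| ≤ A * (1 + |u z|) ^ (critExp n m γ - 1))
    (hsub : SubsolutionAbove γ Ω u V f) :
    ∃ M : ℝ, ∀ᵐ z ∂(volume.restrict Ω), u z ≤ M := by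
  obtain ⟨C, hC, hS'⟩ := exists_sobolev_test (n := n) (m := m) hn hm hγ
  have hS := hS' Ω
  have : IsFiniteMeasure (volume.restrict Ω) := isFiniteMeasure_restrict.2 hΩ
  have hu := (h.memLp_and_tendsto_critExp hn hm hγ).1
  have hq := two_lt_critExp hn hm hγ
  set μ := volume.restrict Ω with hμ
  have hfq := memLp_conjExponent_of_le (by linarith) hu hf hfA
  set q := critExp n m γ
  set N : ℝ → ℝ := fun b => (eLpNorm (fun z => max (u z - b) 0) (ENNReal.ofReal q) μ).toReal with hN
  have hNq : ∀ b, 0 ≤ b → ∫ z, (max (u z - b) 0) ^ q ∂μ = N b ^ q := by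
    intro b hb
    have e := (memLp_posPart hu hb).eLpNorm_eq_integral_rpow_norm (by simp; linarith) (by simp)
    have e2 : ∀ z, ‖max (u z - b) 0‖ = max (u z - b) 0 := fun z =>
      Real.norm_of_nonneg (le_max_right _ _)
    simp only [e2, ENNReal.toReal_ofReal (by linarith : 0 ≤ q)] at e
    have hnn : 0 ≤ ∫ z, (max (u z - b) 0) ^ q ∂μ := integral_nonneg fun z => by positivity
    simp only [hN]
    rw [e, ENNReal.toReal_ofReal (by positivity), ← Real.rpow_mul hnn,
      inv_mul_cancel₀ (by linarith), Real.rpow_one]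
  -- Three levels are needed: the growth bound uses the gap from a' to a, the smooth truncation that
  -- from a to b.
  have hstep : ∀ a' a b : ℝ, 1 ≤ a' → a' < a → a < b →
      N b ^ 2 ≤ C * (A * (2 * (a / (a - a'))) ^ (q - 1) * N a' ^ q) := by
    intro a' a b ha' haa hab
    have hint : Integrable (fun z => (max (u z - a') 0) ^ q) μ := by
      have := (memLp_posPart hu (by linarith : 0 ≤ a')).integrable_norm_rpow
        (by simp; linarith) (by simp)
      rw [ENNReal.toReal_ofReal (by linarith)] at this
      refine this.congr (Eventually.of_forall fun z => ?_)
      simp only [Real.norm_of_nonneg (le_max_right (u z - a') 0)]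
    have h1 := h.eLpNorm_posPart_sq_le hn hm hγ hC hS hfq hsub (by linarith : 0 < a) hab
      (hint.const_mul (A * (2 * (a / (a - a'))) ^ (q - 1))) (by
        filter_upwards [hfA] with z hz
        exact abs_mul_posPart_le (by linarith) hA.le ha' haa hz)
    rw [integral_const_mul, hNq a' (by linarith)] at h1
    have hη : 0 ≤ a / (a - a') := div_nonneg (by linarith) (by linarith)
    have hNn : 0 ≤ N a' := ENNReal.toReal_nonneg
    have h2 := ENNReal.toReal_mono ENNReal.ofReal_ne_top h1
    rwa [ENNReal.toReal_pow, ENNReal.toReal_ofReal (by positivity)] at h2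
  -- K and L come from the bound 2a/(a - a') ≤ 16 · 2^j at the j-th step.
  obtain ⟨ε, hε, hconv⟩ := exists_tendsto_zero_of_superlinear (K := C * A * 16 ^ (q - 1))
    (L := 2 ^ (q - 1)) hq (by positivity)
    (Real.one_le_rpow (by norm_num) (by linarith))
  obtain ⟨k, hk1, hkε⟩ := exists_toReal_eLpNorm_posPart_le (by linarith : 0 < q) hε hu
  have hk : (1 : ℝ) ≤ k := by exact_mod_cast hk1
  have hhalf : ∀ j : ℕ, (0 : ℝ) < 2⁻¹ ^ j ∧ (2⁻¹ : ℝ) ^ j ≤ 1 := fun j =>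
    ⟨by positivity, pow_le_one₀ (by norm_num) (by norm_num)⟩
  set x : ℕ → ℝ := fun j => N (k * (2 - 2⁻¹ ^ j)) with hx
  have hx0 : Tendsto x atTop (𝓝 0) := by
    refine hconv x (fun j => ENNReal.toReal_nonneg) ?_ fun j => ?_
    · simp only [hx, pow_zero]
      norm_num
      exact hkε
    · obtain ⟨hj0, hj1⟩ := hhalf j
      set s : ℝ := 2⁻¹ ^ j with hs
      have e : (2 : ℝ)⁻¹ ^ (j + 1) = s / 2 := by rw [pow_succ]; ring
      have hk0 : (0 : ℝ) < k := by linarith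
      have h1 := hstep (k * (2 - s)) (k * (2 - 3 / 4 * s)) (k * (2 - s / 2))
        (by nlinarith) (by nlinarith) (by nlinarith)
      have h2 : 2 * (k * (2 - 3 / 4 * s) / (k * (2 - 3 / 4 * s) - k * (2 - s))) ≤ 16 * 2 ^ j := by
        have e1 : k * (2 - 3 / 4 * s) - k * (2 - s) = k * (s / 4) := by ring
        have e2 : (2 : ℝ) ^ j = s⁻¹ := by rw [hs, inv_pow, inv_inv]
        rw [e1, e2, mul_div_mul_left _ _ hk0.ne', mul_div_assoc', div_le_iff₀ (by positivity)]
        have : 16 * s⁻¹ * (s / 4) = 4 := by field_simp; norm_num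
        rw [this]
        linarith
      have h0 : 0 ≤ 2 * (k * (2 - 3 / 4 * s) / (k * (2 - 3 / 4 * s) - k * (2 - s))) := by
        refine mul_nonneg two_pos.le (div_nonneg ?_ ?_) <;> nlinarith
      have h3 := Real.rpow_le_rpow h0 h2 (by linarith : 0 ≤ q - 1)
      have h4 : ((16 : ℝ) * 2 ^ j) ^ (q - 1) = 16 ^ (q - 1) * (2 ^ (q - 1)) ^ j := by
        rw [Real.mul_rpow (by norm_num) (by positivity), ← Real.rpow_natCast, ← Real.rpow_natCast,
          ← Real.rpow_mul (by norm_num), ← Real.rpow_mul (by norm_num), mul_comm (j : ℝ)]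
      have hxn : 0 ≤ x j ^ q := Real.rpow_nonneg ENNReal.toReal_nonneg _
      have e3 : x (j + 1) = N (k * (2 - s / 2)) := by simp only [hx, e]
      rw [e3]
      calc _ ≤ C * (A * _ * x j ^ q) := h1
        _ ≤ C * (A * (16 ^ (q - 1) * (2 ^ (q - 1)) ^ j) * x j ^ q) := by
            rw [← h4]
            gcongr
        _ = _ := by ring
  have hle : ∀ j, N (k * 2) ≤ x j := by
    intro j
    have hpos : 0 ≤ (k : ℝ) * (2 - 2⁻¹ ^ j) := mul_nonneg (by linarith) (by linarith [(hhalf j).2])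
    refine ENNReal.toReal_mono (memLp_posPart hu hpos).2.ne
      (eLpNorm_mono_real fun z => ?_)
    rw [Real.norm_of_nonneg (le_max_right _ _)]
    refine max_le_max ?_ le_rfl
    nlinarith [(hhalf j).1]
  have hN0 : N (k * 2) = 0 :=
    le_antisymm (ge_of_tendsto' hx0 hle) ENNReal.toReal_nonneg
  have hk2 : (0 : ℝ) ≤ k * 2 := by linarith
  have hmem := memLp_posPart hu hk2
  have hz := ((ENNReal.toReal_eq_zero_iff _).1 hN0).resolve_right hmem.2.ne
  rw [eLpNorm_eq_zero_iff hmem.1 (by simp; linarith)] at hz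
  refine ⟨k * 2, ?_⟩
  filter_upwards [hz] with z hz
  have : u z - k * 2 ≤ 0 := by
    rw [← show max (u z - k * 2) 0 = 0 from hz]
    exact le_max_left _ _
  linarith

end DeGiorgi

/-! ### Integration by parts and locality of the weak gradient. -/

theorem integrable_inner_of_locallyIntegrableOn {E : Type*} [NormedAddCommGroup E]
    [InnerProductSpace ℝ E] {Ω : Set (Pt n m)} {X g : Pt n m → E}
    (hX : LocallyIntegrableOn X Ω volume) (hg : Continuous g) (hgc : HasCompactSupport g)
    (hgΩ : tsupport g ⊆ Ω) :
    Integrable (fun z => (inner ℝ (X z) (g z) : ℝ)) (volume.restrict Ω) := by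
  have hK := hX.integrableOn_compact_subset hgΩ hgc.isCompact
  obtain ⟨M, hM⟩ := hg.bounded_above_of_compact_support hgc
  have h1 : IntegrableOn (fun z => (inner ℝ (X z) (g z) : ℝ)) (tsupport g) volume := by
    refine (hK.norm.const_mul M).mono' (hK.1.inner hg.aestronglyMeasurable)
      (Eventually.of_forall fun z => ?_)
    refine (norm_inner_le_norm _ _).trans ?_
    rw [mul_comm]
    exact mul_le_mul_of_nonneg_right (hM z) (norm_nonneg _)
  refine ((integrableOn_iff_integrable_of_support_subset ?_).1 h1).restrict
  intro z hz
  refine subset_tsupport g fun h0 => hz ?_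
  simp [h0]

theorem integrable_mul_of_locallyIntegrableOn {Ω : Set (Pt n m)} {v g : Pt n m → ℝ}
    (hv : LocallyIntegrableOn v Ω volume) (hg : Continuous g) (hgc : HasCompactSupport g)
    (hgΩ : tsupport g ⊆ Ω) : Integrable (fun z => v z * g z) (volume.restrict Ω) := by
  refine (integrable_inner_of_locallyIntegrableOn hv hg hgc hgΩ).congr
    (Eventually.of_forall fun z => ?_)
  simp [mul_comm]

theorem memLp_smul_of_memLp_restrict {E : Type*} [NormedAddCommGroup E] [NormedSpace ℝ E]
    {Ω : Set (Pt n m)} {ψ : Pt n m → ℝ} (hψ : IsTest Ω ψ) {X : Pt n m → E}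
    (hX : MemLp X 2 (volume.restrict (tsupport ψ))) :
    MemLp (fun z => ψ z • X z) 2 (volume.restrict Ω) := by
  obtain ⟨M, hM⟩ := hψ.smooth.continuous.bounded_above_of_compact_support hψ.compact
  have h1 : MemLp (fun z => ψ z • X z) 2 (volume.restrict (tsupport ψ)) := by
    refine hX.of_le_mul (c := M) (hψ.smooth.continuous.aestronglyMeasurable.smul hX.1)
      (Eventually.of_forall fun z => ?_)
    rw [norm_smul]
    exact mul_le_mul_of_nonneg_right (hM z) (norm_nonneg _)
  have h2 := (memLp_indicator_iff_restrict hψ.compact.isCompact.measurableSet).2 h1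
  have e : (tsupport ψ).indicator (fun z => ψ z • X z) = fun z => ψ z • X z := by
    rw [Set.indicator_eq_self]
    intro z hz
    refine subset_tsupport ψ fun h0 => hz ?_
    simp [h0]
  rw [e] at h2
  exact h2.restrict Ω

theorem integral_mul_fderiv_eq_zero {f : Pt n m → ℝ} (hf : Continuous f) {v : Pt n m}
    (hfv : ∀ z, HasLineDerivAt ℝ f 0 z v) {ψ : Pt n m → ℝ} (hψ : ContDiff ℝ 1 ψ)
    (hψc : HasCompactSupport ψ) : ∫ z, f z * fderiv ℝ ψ z v = 0 := by
  have hd : Continuous fun z => fderiv ℝ ψ z v :=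
    (hψ.continuous_fderiv one_ne_zero).clm_apply continuous_const
  have hdc : HasCompactSupport fun z => fderiv ℝ ψ z v := by
    refine HasCompactSupport.of_support_subset_isCompact hψc.isCompact fun z hz => ?_
    by_contra h
    exact hz (by simp [fderiv_of_notMem_tsupport ℝ h])
  have := integral_bilinear_hasLineDerivAt_right_eq_neg_left_of_integrable (μ := volume)
    (B := ContinuousLinearMap.mul ℝ ℝ) (f := f) (f' := fun _ => 0) (g := ψ)
    (g' := fun z => fderiv ℝ ψ z v) (v := v) (by simp)
    ((hf.mul hd).integrable_of_hasCompactSupport hdc.mul_left)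
    ((hf.mul hψ.continuous).integrable_of_hasCompactSupport hψc.mul_left)
    (fun z _ => hfv z)
    (fun z _ => ((hψ.differentiable one_ne_zero) z).hasFDerivAt.hasLineDerivAt v)
  simpa using this

/-- Constants have zero weak gradient. The weight |x|^γ may fail to be differentiable at x = 0, but
only its derivative along y is used, and that is zero. -/
theorem IsTest.integral_grad_eq_zero {γ : ℝ} (hγ : 0 < γ) {Ω : Set (Pt n m)} {ψ : Pt n m → ℝ}
    (hψ : IsTest Ω ψ) (k : Fin n ⊕ Fin m) : ∫ z in Ω, grad γ ψ z k = 0 := by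
  rw [setIntegral_eq_integral_of_forall_compl_eq_zero fun z hz => by
    have : grad γ ψ z = 0 := by
      by_contra h
      exact hz (hψ.support (support_grad_subset γ ψ h))
    simp [this]]
  rcases k with i | j
  · have := integral_mul_fderiv_eq_zero (f := fun _ => 1) (v := (EuclideanSpace.single i 1, 0))
      continuous_const (fun z => hasDerivAt_const (0 : ℝ) (1 : ℝ)) hψ.contDiff_one hψ.compact
    simpa [grad_inl] using this
  · refine integral_mul_fderiv_eq_zero (f := fun z => (1 + γ) * ‖z.1‖ ^ γ)
      (v := (0, EuclideanSpace.single j 1))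
      (continuous_const.mul (continuous_fst.norm.rpow_const fun _ => Or.inr hγ.le))
      (fun z => ?_) hψ.contDiff_one hψ.compact
    unfold HasLineDerivAt
    simpa using hasDerivAt_const (0 : ℝ) ((1 + γ) * ‖z.1‖ ^ γ)

theorem continuous_grad_apply {γ : ℝ} (hγ : 0 < γ) {ψ : Pt n m → ℝ} (hψ : ContDiff ℝ 1 ψ)
    (k : Fin n ⊕ Fin m) : Continuous fun z => grad γ ψ z k :=
  (PiLp.continuous_apply 2 _ k).comp (continuous_grad hγ hψ)

theorem support_grad_apply_subset (γ : ℝ) (ψ : Pt n m → ℝ) (k : Fin n ⊕ Fin m) :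
    Function.support (fun z => grad γ ψ z k) ⊆ tsupport ψ := fun z hz =>
  support_grad_subset γ ψ fun h0 => hz (by simp [h0])

theorem IsTest.integrable_mul_grad {γ : ℝ} (hγ : 0 < γ) {Ω : Set (Pt n m)} {ψ : Pt n m → ℝ}
    (hψ : IsTest Ω ψ) {v : Pt n m → ℝ} (hv : LocallyIntegrableOn v Ω volume)
    (k : Fin n ⊕ Fin m) : Integrable (fun z => v z * grad γ ψ z k) (volume.restrict Ω) := by
  have hs := support_grad_apply_subset γ ψ k
  have ht : tsupport (fun z => grad γ ψ z k) ⊆ tsupport ψ :=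
    closure_minimal hs (isClosed_tsupport ψ)
  exact integrable_mul_of_locallyIntegrableOn hv (continuous_grad_apply hγ hψ.contDiff_one k)
    (HasCompactSupport.of_support_subset_isCompact hψ.compact.isCompact hs) (ht.trans hψ.support)

theorem IsTest.integrable_inner_grad {γ : ℝ} (hγ : 0 < γ) {Ω : Set (Pt n m)} {ψ : Pt n m → ℝ}
    (hψ : IsTest Ω ψ) {X : Pt n m → Grad n m} (hX : LocallyIntegrableOn X Ω volume) :
    Integrable (fun z => (inner ℝ (X z) (grad γ ψ z) : ℝ)) (volume.restrict Ω) := by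
  have ht : tsupport (grad γ ψ) ⊆ tsupport ψ :=
    closure_minimal (support_grad_subset γ ψ) (isClosed_tsupport ψ)
  exact integrable_inner_of_locallyIntegrableOn hX (continuous_grad hγ hψ.contDiff_one)
    (hψ.hasCompactSupport_grad γ) (ht.trans hψ.support)

theorem IsTest.integrable_mul {Ω : Set (Pt n m)} {ψ : Pt n m → ℝ} (hψ : IsTest Ω ψ)
    {v : Pt n m → ℝ} (hv : LocallyIntegrableOn v Ω volume) :
    Integrable (fun z => v z * ψ z) (volume.restrict Ω) :=
  integrable_mul_of_locallyIntegrableOn hv hψ.smooth.continuous hψ.compact hψ.support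

theorem locallyIntegrableOn_apply {Ω : Set (Pt n m)} {X : Pt n m → Grad n m}
    (hX : LocallyIntegrableOn X Ω volume) (k : Fin n ⊕ Fin m) :
    LocallyIntegrableOn (fun z => X z k) Ω volume := fun z hz => by
  obtain ⟨t, ht, hi⟩ := hX z hz
  refine ⟨t, ht, hi.norm.mono' ((PiLp.continuous_apply 2 _ k).comp_aestronglyMeasurable hi.1)
    (Eventually.of_forall fun z => PiLp.norm_apply_le _ _)⟩

/-- The weak gradient of `u - w - c`. -/
theorem IsWeakGrad.sub_sub_const {γ : ℝ} (hγ : 0 < γ) {Ω : Set (Pt n m)} {u w : Pt n m → ℝ}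
    {U W : Pt n m → Grad n m} (hu : IsWeakGrad γ Ω u U) (hw : IsWeakGrad γ Ω w W) (c : ℝ) :
    IsWeakGrad γ Ω (fun z => u z - w z - c) (fun z => U z - W z) where
  locInt := (hu.locInt.sub hw.locInt).sub (locallyIntegrableOn_const c)
  locInt_grad := hu.locInt_grad.sub hw.locInt_grad
  by_parts ψ hψ k := by
    have e1 := hψ.integrable_mul_grad hγ hu.locInt k
    have e2 := hψ.integrable_mul_grad hγ hw.locInt k
    have e3 := hψ.integrable_mul_grad hγ (locallyIntegrableOn_const (μ := volume) c) k
    have e4 := hψ.integrable_mul (locallyIntegrableOn_apply hu.locInt_grad k)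
    have e5 := hψ.integrable_mul (locallyIntegrableOn_apply hw.locInt_grad k)
    have h0 : ∫ z in Ω, c * grad γ ψ z k = 0 := by
      rw [integral_const_mul, hψ.integral_grad_eq_zero hγ k, mul_zero]
    simp only [PiLp.sub_apply, sub_mul]
    have e12 : Integrable (fun z => u z * grad γ ψ z k - w z * grad γ ψ z k)
      (volume.restrict Ω) := e1.sub e2
    rw [integral_sub e12 e3, integral_sub e1 e2, integral_sub e4 e5, h0,
      hu.by_parts ψ hψ k, hw.by_parts ψ hψ k]
    ring

/-- A bounded smooth function of an element of `H¹_{0,γ}(Ω)` may be used as a factor of a test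
function in the definition of the weak gradient. -/
theorem Approx.by_parts_mul_comp {γ : ℝ} (hγ : 0 < γ) {Ω : Set (Pt n m)} {w v : Pt n m → ℝ}
    {W Z : Pt n m → Grad n m} {φ : ℕ → Pt n m → ℝ} (h : Approx γ Ω w W φ)
    (hv : IsWeakGrad γ Ω v Z)
    (hv2 : ∀ K : Set (Pt n m), IsCompact K → K ⊆ Ω → MemLp v 2 (volume.restrict K))
    {G : ℝ → ℝ} (hG : ContDiff ℝ ∞ G) {M : ℝ} (hG1 : ∀ t, |G t| ≤ M) (hG2 : ∀ t, |deriv G t| ≤ M)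
    {ψ : Pt n m → ℝ} (hψ : IsTest Ω ψ) (k : Fin n ⊕ Fin m) :
    (∫ z in Ω, G (w z) * (v z * grad γ ψ z k)) +
      (∫ z in Ω, deriv G (w z) * inner ℝ (ψ z • v z • EuclideanSpace.single k (1 : ℝ)) (W z)) =
        -∫ z in Ω, G (w z) * (Z z k * ψ z) := by
  have hGone : ContDiff ℝ 1 G := hG.of_le (by exact_mod_cast le_top)
  have hGd : Continuous (deriv G) := hGone.continuous_deriv le_rfl
  -- The k-th component of W, multiplied by ψ v, is written as an inner product with an L² field, so
  -- that the L² convergence of the gradients applies.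
  set X : Pt n m → Grad n m := fun z => ψ z • v z • EuclideanSpace.single k (1 : ℝ)
  have hX : MemLp X 2 (volume.restrict Ω) := by
    refine memLp_smul_of_memLp_restrict hψ ?_
    have := hv2 _ hψ.compact.isCompact hψ.support
    refine this.of_le (this.1.smul aestronglyMeasurable_const) (Eventually.of_forall fun z => ?_)
    rw [norm_smul]
    simp
  have i1 := hψ.integrable_mul_grad hγ hv.locInt k
  have i3 := hψ.integrable_mul (locallyIntegrableOn_apply hv.locInt_grad k)
  have hg := fun l => (h.test l).memLp_grad hγ 2 (volume.restrict Ω)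
  have hGm : ∀ l, AEStronglyMeasurable (fun z => G (φ l z)) (volume.restrict Ω) := fun l =>
    (hG.continuous.comp (h.test l).smooth.continuous).aestronglyMeasurable
  have hGm' : ∀ l, AEStronglyMeasurable (fun z => deriv G (φ l z)) (volume.restrict Ω) := fun l =>
    (hGd.comp (h.test l).smooth.continuous).aestronglyMeasurable
  have t1 := tendsto_integral_mul_of_bounded (h := fun _ z => v z * grad γ ψ z k) (fun _ => i1) i1
    (by simp) hGm (fun l z => hG1 (φ l z)) (h.ae_tendsto_comp hG.continuous)
  have t2 := tendsto_integral_mul_of_bounded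
    (fun l => integrable_inner_of_memLp hX (hg l)) (integrable_inner_of_memLp hX h.memLp_grad)
    (tendsto_eLpNorm_inner_sub (fun _ => hX) hg hX h.memLp_grad (by simp) h.lim_grad)
    hGm' (fun l z => hG2 (φ l z)) (h.ae_tendsto_comp hGd)
  have t3 := tendsto_integral_mul_of_bounded (h := fun _ z => Z z k * ψ z) (fun _ => i3) i3
    (by simp) hGm (fun l z => hG1 (φ l z)) (h.ae_tendsto_comp hG.continuous)
  refine tendsto_nhds_unique (t1.add t2) (t3.neg.congr fun l => ?_)
  have j1 : Integrable (fun z => G (φ l z) * (v z * grad γ ψ z k)) (volume.restrict Ω) :=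
    i1.bdd_mul (hGm l) (Eventually.of_forall fun z => hG1 _)
  have j2 : Integrable (fun z => deriv G (φ l z) * inner ℝ (X z) (grad γ (φ l) z))
      (volume.restrict Ω) :=
    (integrable_inner_of_memLp hX (hg l)).bdd_mul (hGm' l) (Eventually.of_forall fun z => hG2 _)
  have hbp := hv.by_parts _ (hψ.mul_smooth (hG.comp (h.test l).smooth)) k
  rw [← integral_add j1 j2]
  have e1 : ∫ z in Ω, Z z k * (ψ z * (G ∘ φ l) z) = ∫ z in Ω, G (φ l z) * (Z z k * ψ z) := by
    congr 1 with z
    simp only [Function.comp_apply]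
    ring
  rw [e1] at hbp
  rw [← hbp]
  congr 1 with z
  have hc : Differentiable ℝ (fun z => G (φ l z)) :=
    (hGone.differentiable one_ne_zero).comp (h.test l).differentiable
  have e2 : grad γ (fun z => ψ z * (G ∘ φ l) z) z =
      G (φ l z) • grad γ ψ z + ψ z • (deriv G (φ l z) • grad γ (φ l) z) := by
    rw [← grad_comp γ (hGone.differentiable one_ne_zero) (h.test l).differentiable]
    exact grad_mul γ hψ.differentiable hc z
  rw [e2]
  simp only [X, PiLp.add_apply, PiLp.smul_apply, smul_eq_mul, inner_smul_left,
    EuclideanSpace.inner_single_left, map_one, one_mul, conj_trivial]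
  ring

/-- Locality of the weak gradient: it vanishes on `{w > 0}` if the function does. -/
theorem Approx.weakGrad_eq_zero {γ : ℝ} (hγ : 0 < γ) {Ω : Set (Pt n m)} (hΩ : IsOpen Ω)
    {w v : Pt n m → ℝ} {W Z : Pt n m → Grad n m} {φ : ℕ → Pt n m → ℝ} (h : Approx γ Ω w W φ)
    (hv : IsWeakGrad γ Ω v Z)
    (hv2 : ∀ K : Set (Pt n m), IsCompact K → K ⊆ Ω → MemLp v 2 (volume.restrict K))
    (hv0 : ∀ z, 0 < w z → v z = 0) :
    ∀ᵐ z ∂(volume.restrict Ω), 0 < w z → Z z = 0 := by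
  obtain ⟨M, hM, hτ⟩ := exists_deriv_smoothTransition_le
  have hG : ContDiff ℝ ∞ Real.smoothTransition := Real.smoothTransition.contDiff
  have hcomp : ∀ k, ∀ᵐ z ∂(volume.restrict Ω),
      z ∈ Ω → Real.smoothTransition (w z) * Z z k = 0 := by
    intro k
    refine hΩ.ae_eq_zero_of_integral_contDiff_smul_eq_zero ?_ fun ψ hψ hψc hψΩ => ?_
    · have h1 : LocallyIntegrableOn (fun z => Z z k) Ω (volume.restrict Ω) := fun z hz => by
        obtain ⟨t, ht, hi⟩ := locallyIntegrableOn_apply hv.locInt_grad k z hz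
        exact ⟨t, ht, hi.mono_measure Measure.restrict_le_self⟩
      refine h1.mono ((hG.continuous.comp_aestronglyMeasurable h.memLp.1).mul
        (locallyIntegrableOn_apply hv.locInt_grad k).aestronglyMeasurable)
        (Eventually.of_forall fun z => ?_)
      rw [norm_mul]
      refine mul_le_of_le_one_left (norm_nonneg _) ?_
      rw [Real.norm_of_nonneg (Real.smoothTransition.nonneg _)]
      exact Real.smoothTransition.le_one _
    · have hbp := h.by_parts_mul_comp hγ hv hv2 hG (M := max M 1)
        (fun t => by
          rw [abs_of_nonneg (Real.smoothTransition.nonneg _)]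
          exact (Real.smoothTransition.le_one _).trans (le_max_right _ _))
        (fun t => (hτ t).trans (le_max_left _ _)) ⟨hψ, hψc, hψΩ⟩ k
      have z1 : ∀ z, Real.smoothTransition (w z) * (v z * grad γ ψ z k) = 0 := fun z => by
        -- For w ≤ 0 the smooth step and its derivative vanish, for w > 0 the function v does; only
        -- the term with Z survives.
        rcases le_or_gt (w z) 0 with hz | hz
        · simp [Real.smoothTransition.zero_of_nonpos hz]
        · simp [hv0 z hz]
      have z2 : ∀ z, deriv Real.smoothTransition (w z) *
          inner ℝ (ψ z • v z • EuclideanSpace.single k (1 : ℝ)) (W z) = 0 := fun z => by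
        rcases le_or_gt (w z) 0 with hz | hz
        · simp [deriv_smoothTransition_eq_zero (Or.inl hz)]
        · simp [hv0 z hz]
      simp only [z1, z2, integral_zero, add_zero] at hbp
      rw [eq_comm, neg_eq_zero] at hbp
      rw [← hbp]
      congr 1 with z
      simp only [smul_eq_mul]
      ring
  filter_upwards [ae_all_iff.2 hcomp, ae_restrict_mem hΩ.measurableSet] with z hz hzΩ hw
  ext k
  exact (mul_eq_zero.1 (hz k hzΩ)).resolve_left (Real.smoothTransition.pos_of_pos hw).ne'

/-! ### Kato's inequality and the bounds for u₀ and u. -/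

theorem deriv_smoothTransition_nonneg (t : ℝ) : 0 ≤ deriv Real.smoothTransition t :=
  Real.smoothTransition.monotone.deriv_nonneg

/-- Kato's inequality for the singular solution: `(u₀ - c)⁺` is a subsolution for the right-hand
side `c^{-δ}`. -/
theorem IsSingularSolution.subsolutionAbove {γ δ : ℝ} (hγ : 0 < γ) (hδ : 0 < δ)
    {Ω : Set (Pt n m)} (hΩ : IsOpen Ω) {u₀ : Pt n m → ℝ} (hu₀ : IsSingularSolution γ δ Ω u₀)
    {c : ℝ} (hc : 0 < c) {W : Pt n m → Grad n m} {φ : ℕ → Pt n m → ℝ}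
    (h : Approx γ Ω (fun z => max (u₀ z - c) 0) W φ) :
    SubsolutionAbove γ Ω (fun z => max (u₀ z - c) 0) W (fun _ => c ^ (-δ)) := by
  obtain ⟨V₀, hV₀, hloc⟩ := hu₀.memH1Loc
  set w : Pt n m → ℝ := fun z => max (u₀ z - c) 0 with hw
  -- V₀ - W is the weak gradient of u₀ - w - c, which is zero where w > 0.
  have hVW : ∀ᵐ z ∂(volume.restrict Ω), 0 < w z → V₀ z - W z = 0 := by
    refine h.weakGrad_eq_zero hγ hΩ (hV₀.sub_sub_const hγ h.weak c) (fun K hK hKΩ => ?_)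
      fun z hz => ?_
    · have : IsFiniteMeasure (volume.restrict K) := isFiniteMeasure_restrict.2 hK.measure_lt_top.ne
      exact ((hloc K hK hKΩ).1.sub (h.memLp.mono_measure (Measure.restrict_mono hKΩ le_rfl))).sub
        (memLp_const c)
    · have : 0 < u₀ z - c := by
        by_contra hn
        simp [hw, max_eq_right (not_lt.1 hn)] at hz
      simp only [hw, max_eq_left this.le]
      ring
  intro a ha
  -- H(w) is a smooth nondecreasing substitute for the indicator of {w > 0}, equal to 1 where w ≥ a;
  -- it is the θ sought.
  set H : ℝ → ℝ := fun t => Real.smoothTransition (t / a) with hH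
  have hHs : ContDiff ℝ ∞ H := Real.smoothTransition.contDiff.comp (by fun_prop)
  have hHone : ContDiff ℝ 1 H := hHs.of_le (by exact_mod_cast le_top)
  have hHd : Continuous (deriv H) := hHone.continuous_deriv le_rfl
  have hH0 : ∀ t ≤ 0, H t = 0 := fun t ht =>
    Real.smoothTransition.zero_of_nonpos (div_nonpos_of_nonpos_of_nonneg ht ha.le)
  have hHn : ∀ t, 0 ≤ H t := fun t => Real.smoothTransition.nonneg _
  have hH1 : ∀ t, H t ≤ 1 := fun t => Real.smoothTransition.le_one _
  have hHabs : ∀ t, |H t| ≤ 1 := fun t => by rw [abs_of_nonneg (hHn t)]; exact hH1 t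
  have hHder : ∀ t, deriv H t = deriv Real.smoothTransition (t / a) * a⁻¹ := fun t => by
    have h1 : HasDerivAt (fun t : ℝ => t / a) a⁻¹ t := by
      simpa using (hasDerivAt_id t).div_const a
    exact (((Real.smoothTransition.contDiff (n := 1)).differentiable one_ne_zero
      _).hasDerivAt.comp t h1).deriv
  have hHdn : ∀ t, 0 ≤ deriv H t := fun t => by
    rw [hHder]; exact mul_nonneg (deriv_smoothTransition_nonneg _) (inv_nonneg.2 ha.le)
  have hHd0 : ∀ t ≤ 0, deriv H t = 0 := fun t ht => by
    rw [hHder, deriv_smoothTransition_eq_zero (Or.inl (div_nonpos_of_nonpos_of_nonneg ht ha.le)),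
      zero_mul]
  obtain ⟨M, hM, hτ⟩ := exists_deriv_smoothTransition_le
  have hHdM : ∀ t, |deriv H t| ≤ M * a⁻¹ := fun t => by
    rw [hHder, abs_mul, abs_of_pos (inv_pos.2 ha)]
    exact mul_le_mul_of_nonneg_right (hτ _) (inv_nonneg.2 ha.le)
  refine ⟨fun z => H (w z), hHs.continuous.comp_aestronglyMeasurable h.memLp.1, fun z => hHabs _,
    fun z hz => Real.smoothTransition.one_of_one_le (by rwa [le_div_iff₀ ha, one_mul]), ?_⟩
  intro ψ hψ hψ0
  have hX : MemLp (fun z => ψ z • V₀ z) 2 (volume.restrict Ω) :=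
    memLp_smul_of_memLp_restrict hψ (hloc _ hψ.compact.isCompact hψ.support).2
  have i1 := hψ.integrable_inner_grad hγ hV₀.locInt_grad
  have i3 := hψ.integrable_mul hu₀.locInt
  have hg := fun l => (h.test l).memLp_grad hγ 2 (volume.restrict Ω)
  have hHm : ∀ l, AEStronglyMeasurable (fun z => H (φ l z)) (volume.restrict Ω) := fun l =>
    (hHs.continuous.comp (h.test l).smooth.continuous).aestronglyMeasurable
  have hHm' : ∀ l, AEStronglyMeasurable (fun z => deriv H (φ l z)) (volume.restrict Ω) := fun l =>
    (hHd.comp (h.test l).smooth.continuous).aestronglyMeasurable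
  have t1 := tendsto_integral_mul_of_bounded (h := fun _ z => inner ℝ (V₀ z) (grad γ ψ z))
    (fun _ => i1) i1 (by simp) hHm (fun l z => hHabs (φ l z)) (h.ae_tendsto_comp hHs.continuous)
  have t2 := tendsto_integral_mul_of_bounded
    (fun l => integrable_inner_of_memLp hX (hg l)) (integrable_inner_of_memLp hX h.memLp_grad)
    (tendsto_eLpNorm_inner_sub (fun _ => hX) hg hX h.memLp_grad (by simp) h.lim_grad)
    hHm' (fun l z => hHdM (φ l z)) (h.ae_tendsto_comp hHd)
  have t3 := tendsto_integral_mul_of_bounded (h := fun _ z => u₀ z ^ (-δ) * ψ z) (fun _ => i3) i3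
    (by simp) hHm (fun l z => hHabs (φ l z)) (h.ae_tendsto_comp hHs.continuous)
  -- The equation for u₀ is tested with ψ H(φ_l), and l tends to infinity.
  have heq : (∫ z in Ω, H (w z) * inner ℝ (V₀ z) (grad γ ψ z)) +
      ∫ z in Ω, deriv H (w z) * inner ℝ (ψ z • V₀ z) (W z) =
        ∫ z in Ω, H (w z) * (u₀ z ^ (-δ) * ψ z) := by
    refine tendsto_nhds_unique (t1.add t2) (t3.congr fun l => ?_)
    have j1 : Integrable (fun z => H (φ l z) * inner ℝ (V₀ z) (grad γ ψ z)) (volume.restrict Ω) :=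
      i1.bdd_mul (hHm l) (Eventually.of_forall fun z => hHabs _)
    have j2 : Integrable (fun z => deriv H (φ l z) * inner ℝ (ψ z • V₀ z) (grad γ (φ l) z))
        (volume.restrict Ω) :=
      (integrable_inner_of_memLp hX (hg l)).bdd_mul (hHm' l) (Eventually.of_forall fun z => hHdM _)
    have he := hu₀.eqn V₀ hV₀ _ (hψ.mul_smooth (hHs.comp (h.test l).smooth))
    rw [← integral_add j1 j2]
    have e1 : ∫ z in Ω, u₀ z ^ (-δ) * (ψ z * (H ∘ φ l) z) =
        ∫ z in Ω, H (φ l z) * (u₀ z ^ (-δ) * ψ z) := by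
      congr 1 with z
      simp only [Function.comp_apply]
      ring
    rw [← e1, ← he]
    congr 1 with z
    have hcd : Differentiable ℝ (fun z => H (φ l z)) :=
      (hHone.differentiable one_ne_zero).comp (h.test l).differentiable
    have e2 : grad γ (fun z => ψ z * (H ∘ φ l) z) z =
        H (φ l z) • grad γ ψ z + ψ z • (deriv H (φ l z) • grad γ (φ l) z) := by
      rw [← grad_comp γ (hHone.differentiable one_ne_zero) (h.test l).differentiable]
      exact grad_mul γ hψ.differentiable hcd z
    rw [e2]
    simp only [inner_add_right, inner_smul_right, inner_smul_left, conj_trivial]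
    ring
  -- The heart of Kato's inequality: where H'(w) ≠ 0 the two gradients agree, so the cross term is
  -- H'(w) ψ |W|² ≥ 0 and can be discarded.
  have hpos : 0 ≤ ∫ z in Ω, deriv H (w z) * inner ℝ (ψ z • V₀ z) (W z) := by
    refine integral_nonneg_of_ae ?_
    filter_upwards [hVW] with z hz
    rcases le_or_gt (w z) 0 with hz0 | hz0
    · simp [hHd0 _ hz0]
    · rw [sub_eq_zero.1 (hz hz0), inner_smul_left, real_inner_self_eq_norm_sq]
      exact mul_nonneg (hHdn _) (mul_nonneg (hψ0 z) (sq_nonneg _))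
  have hVWint : ∫ z in Ω, H (w z) * inner ℝ (V₀ z) (grad γ ψ z) =
      ∫ z in Ω, H (w z) * inner ℝ (W z) (grad γ ψ z) := by
    refine integral_congr_ae ?_
    filter_upwards [hVW] with z hz
    rcases le_or_gt (w z) 0 with hz0 | hz0
    · simp [hH0 _ hz0]
    · rw [sub_eq_zero.1 (hz hz0)]
  have hrhs : ∫ z in Ω, H (w z) * (u₀ z ^ (-δ) * ψ z) ≤ ∫ z in Ω, c ^ (-δ) * ψ z := by
    refine integral_mono (i3.bdd_mul (hHs.continuous.comp_aestronglyMeasurable h.memLp.1)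
      (Eventually.of_forall fun z => hHabs _))
      ((memLp_one_iff_integrable.1 (hψ.memLp 1 _)).const_mul _) fun z => ?_
    have hcδ : 0 ≤ c ^ (-δ) := by positivity
    rcases le_or_gt (w z) 0 with hz0 | hz0
    · simp only [hH0 _ hz0, zero_mul]
      exact mul_nonneg hcδ (hψ0 z)
    · have hu : c ≤ u₀ z := by
        by_contra hn
        simp [hw, max_eq_right (by linarith [not_le.1 hn] : u₀ z - c ≤ 0)] at hz0
      have h1 : u₀ z ^ (-δ) ≤ c ^ (-δ) := Real.rpow_le_rpow_of_nonpos hc hu (by linarith)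
      have h2 : 0 ≤ u₀ z ^ (-δ) := Real.rpow_nonneg (hc.le.trans hu) _
      exact (mul_le_of_le_one_left (mul_nonneg h2 (hψ0 z)) (hH1 _)).trans
        (mul_le_mul_of_nonneg_right h1 (hψ0 z))
  rw [← hVWint]
  linarith

/-- The solution of the purely singular problem is bounded. -/
theorem IsSingularSolution.exists_ae_le (hn : 1 ≤ n) (hm : 1 ≤ m) {γ δ : ℝ} (hγ : 0 < γ)
    (hδ : 0 < δ) {Ω : Set (Pt n m)} (hΩ : IsOpen Ω) (hΩf : volume Ω ≠ ⊤) {u₀ : Pt n m → ℝ}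
    (hu₀ : IsSingularSolution γ δ Ω u₀) : ∃ M : ℝ, ∀ᵐ z ∂(volume.restrict Ω), u₀ z ≤ M := by
  obtain ⟨W, φ, h⟩ := (hu₀.bdry_le 1 one_pos).exists_approx
  have hq := two_lt_critExp hn hm hγ
  obtain ⟨M, hM⟩ := h.exists_ae_le hn hm hγ hΩf aestronglyMeasurable_const one_pos
    (Eventually.of_forall fun z => by
      rw [Real.one_rpow, abs_one, one_mul]
      exact Real.one_le_rpow (by linarith [abs_nonneg (max (u₀ z - 1) 0)]) (by linarith))
    (hu₀.subsolutionAbove hγ hδ hΩ one_pos h)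
  refine ⟨M + 1, ?_⟩
  filter_upwards [hM] with z hz
  linarith [le_max_left (u₀ z - 1) 0]

/-- A nonnegative solution of the translated problem is a subsolution of the problem without the
singular term. -/
theorem IsTranslatedSolution.subsolutionAbove {γ δ lam p : ℝ} (hδ : 0 < δ) {Ω : Set (Pt n m)}
    {u₀ u : Pt n m → ℝ} (hpos : ∀ᵐ z ∂(volume.restrict Ω), 0 < u₀ z)
    (hu : IsTranslatedSolution γ δ lam p Ω u₀ u)
    (hu_nonneg : ∀ᵐ z ∂(volume.restrict Ω), 0 ≤ u z) {V : Pt n m → Grad n m}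
    (hV : IsWeakGrad γ Ω u V) :
    SubsolutionAbove γ Ω u V (fun z => lam * (u z + u₀ z) ^ p) := by
  refine fun a _ => ⟨fun _ => 1, aestronglyMeasurable_const, by simp, fun _ _ => rfl,
    fun ψ hψ hψ0 => ?_⟩
  have he := hu.eqn V hV ψ hψ
  have hg : 0 ≤ ∫ z in Ω, (transG δ u₀ z (u z)).toReal * ψ z := by
    refine integral_nonneg_of_ae ?_
    filter_upwards [hpos, hu_nonneg] with z hz hz'
    refine mul_nonneg ?_ (hψ0 z)
    have hs : 0 < u z + u₀ z := by linarith
    rw [transG, if_pos hs, EReal.toReal_coe, sub_nonneg]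
    exact Real.rpow_le_rpow_of_nonpos hz (by linarith) (by linarith)
  simp only [one_mul]
  linarith

theorem IsTranslatedSolution.exists_ae_le (hn : 1 ≤ n) (hm : 1 ≤ m) {γ δ lam p : ℝ} (hγ : 0 < γ)
    (hδ : 0 < δ) (hlam : 0 < lam) (hp : 1 ≤ p) (hpc : p ≤ critExp n m γ - 1) {Ω : Set (Pt n m)}
    (hΩ : IsOpen Ω) (hΩf : volume Ω ≠ ⊤) {u₀ u : Pt n m → ℝ} (hu₀ : IsSingularSolution γ δ Ω u₀)
    (hu : IsTranslatedSolution γ δ lam p Ω u₀ u)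
    (hu_nonneg : ∀ᵐ z ∂(volume.restrict Ω), 0 ≤ u z) :
    ∃ M : ℝ, ∀ᵐ z ∂(volume.restrict Ω), u z ≤ M := by
  obtain ⟨M₀, hM₀⟩ := hu₀.exists_ae_le hn hm hγ hδ hΩ hΩf
  obtain ⟨V, φ, h⟩ := hu.memH10.exists_approx
  obtain ⟨V₀, hV₀, -⟩ := hu₀.memH1Loc
  have hfm : AEStronglyMeasurable (fun z => lam * (u z + u₀ z) ^ p) (volume.restrict Ω) :=
    (((h.memLp.1.add hV₀.locInt.aestronglyMeasurable).aemeasurable.pow_const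
      p).const_mul lam).aestronglyMeasurable
  -- This B satisfies u + u₀ ≤ B(1 + u), which turns the right-hand side into a power of 1 + u
  -- alone.
  set B : ℝ := 1 + max M₀ 0 with hB
  have hB1 : 1 ≤ B := by simp [hB]
  refine h.exists_ae_le hn hm hγ hΩf hfm (A := lam * B ^ p) (by positivity) ?_
    (hu.subsolutionAbove hδ hu₀.pos hu_nonneg h.weak)
  filter_upwards [hM₀, hu₀.pos, hu_nonneg] with z h1 h2 h3
  rw [abs_of_nonneg (by positivity), mul_assoc, abs_of_nonneg h3]
  refine mul_le_mul_of_nonneg_left ?_ hlam.le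
  have h4 : u z + u₀ z ≤ B * (1 + u z) := by
    have : u₀ z ≤ max M₀ 0 := h1.trans (le_max_left _ _)
    nlinarith
  calc (u z + u₀ z) ^ p ≤ (B * (1 + u z)) ^ p :=
        Real.rpow_le_rpow (by linarith) h4 (by linarith)
    _ = B ^ p * (1 + u z) ^ p := Real.mul_rpow (by linarith) (by linarith)
    _ ≤ B ^ p * (1 + u z) ^ (critExp n m γ - 1) := by
        refine mul_le_mul_of_nonneg_left ?_ (by positivity)
        exact Real.rpow_le_rpow_of_exponent_le (by linarith) hpc

end Grushin

end

theorem mainTheorem11 (n m : ℕ) (hn : 1 ≤ n) (hm : 1 ≤ m) (γ δ lam p : ℝ)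
    (hγ : 0 < γ) (hδ : 0 < δ) (hlam : 0 < lam)
    (hp : 1 ≤ p) (hpc : p ≤ Grushin.critExp n m γ - 1)
    (Ω : Set (Grushin.Pt n m)) (hΩo : IsOpen Ω) (hΩc : IsConnected Ω)
    (hΩb : Bornology.IsBounded Ω)
    (u₀ : Grushin.Pt n m → ℝ) (hu₀ : Grushin.IsSingularSolution γ δ Ω u₀)
    (u : Grushin.Pt n m → ℝ) (hu : Grushin.IsTranslatedSolution γ δ lam p Ω u₀ u)
    (hu_nonneg : ∀ᵐ z ∂(volume.restrict Ω), 0 ≤ u z) :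
    (∀ r : ℝ, 1 ≤ r → MemLp u (ENNReal.ofReal r) (volume.restrict Ω)) ∧
      MemLp u ⊤ (volume.restrict Ω) := by
  have hΩf : volume Ω ≠ ⊤ := hΩb.measure_lt_top.ne
  have : IsFiniteMeasure (volume.restrict Ω) := isFiniteMeasure_restrict.2 hΩf
  obtain ⟨M, hM⟩ := hu.exists_ae_le hn hm hγ hδ hlam hp hpc hΩo hΩf hu₀ hu_nonneg
  have htop : MemLp u ⊤ (volume.restrict Ω) := by
    refine memLp_top_of_bound hu.memH10.1.1 M ?_
    filter_upwards [hM, hu_nonneg] with z h1 h2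
    rwa [Real.norm_of_nonneg h2]
  exact ⟨fun r _ => htop.mono_exponent le_top, htop⟩
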